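/- All vector spaces are over $\mathbb C$. Let $V$ be a vertex algebra, with $Tv=v_{(-2)}|0\rangle$. A $V$-module is a vector space $M$ with $T\in\operatorname{End}(M)$ and a linear map $v\mapsto Y(v,z)=\sum_{n\in\mathbb Z}v_{(n)}z^{-n-1}$ from $V$ to $\operatorname{Hom}(M,M((z)))$ such that $Y(|0\rangle,z)=\mathrm{Id}_M$, $[T,Y(v,z)]=\partial_zY(v,z)$, and the Borcherds identity below holds with $a\in V$, $b\in M$ and $\mathcal Y=Y$. For a $V$-module $M$, $v\in V$, $x\in M$ put $v\cdot x=v_{(-1)}x$ and $[v_\lambda x]=\sum_{j\ge0}\frac{\lambda^j}{j!}v_{(j)}x\in M[\lambda]$. Let $\Gamma\subset\mathbb C$ with $\Gamma+\mathbb Z=\Gamma$ and $\Gamma/\mathbb Z$ finite, and let $M_1,M_2,M_3$ be $V$-modules. Let $M_3[\![z]\!]z^{-\Gamma}$ (resp. $M_3[\![\lambda^{-1}]\!]\lambda^{\Gamma}$) be the space of series whose exponents lie in finitely many sets $-d+\mathbb Z_{\ge0}$ (resp. $d-\mathbb Z_{\ge0}$), $d\in\Gamma$. Put $\lambda^{(n)}=\lambda^n/\Gamma(n+1)$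 for $n\in\mathbb C$, where $1/\Gamma(n+1)$ is the inverse of the Gamma function ($0$ for $n\in\mathbb Z_{<0}$). An intertwining operator of type $\binom{M_3}{M_1\ M_2}$ is a linear map $\mathcal Y:M_1\to\operatorname{Hom}(M_2,M_3[\![z]\!]z^{-\Gamma})$, $\mathcal Y(a,z)=\sum_{n\in\mathbb C}a_{(n)}z^{-n-1}$, with $[T,\mathcal Y(a,z)]=\mathcal Y(Ta,z)=\partial_z\mathcal Y(a,z)$ and, for all $v\in V$, $a\in M_1$, $n\in\mathbb Z$ (with $z_{12}=z_1-z_2$), $$\iota_{z_1,z_2}z_{12}^nY(v,z_1)\mathcal Y(a,z_2)-\iota_{z_2,z_1}z_{12}^n\mathcal Y(a,z_2)Y(v,z_1)=\sum_{i\ge0}\mathcal Y(v_{(n+i)}a,z_2)\,\tfrac1{i!}\partial_{z_2}^{i}\delta(z_1,z_2).$$ **Theorem.** The map $\mathcal Y\mapsto\big([a_\lambda b]:=\sum_{n}\lambda^{(n)}a_{(n)}b,\ a\cdot b:=a_{(-1)}b\big)$ is a bijection from the set of intertwining operators of type $\binom{M_3}{M_1\ M_2}$ to the set of pairs of bilinear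 maps $[\cdot_\lambda\cdot]:M_1\times M_2\to M_3[\![\lambda^{-1}]\!]\lambda^\Gamma$ and $\cdot:M_1\times M_2\to M_3$ (with $\cdot=0$ if $0\notin\Gamma$) such that $[a_\lambda b]=\sum_{n\in\mathbb C\setminus\mathbb Z_{<0}}\lambda^{(n)}c_{(n)}$ with $c_{(n)}\in M_3$, $T(a\cdot b)=Ta\cdot b+a\cdot Tb$, and for all $v\in V$, $a\in M_1$, $b\in M_2$: 1. (i) $[Ta_\lambda b]=-\lambda[a_\lambda b]$ and $[a_\lambda Tb]=(\lambda+T)[a_\lambda b]$; 2. (ii) $[v_\lambda[a_\mu b]]=[a_\mu[v_\lambda b]]+\iota_{\mu,\lambda}[[v_\lambda a]_{\lambda+\mu}b]$; 3. (iii) $(va)b-v(ab)=\big(\int_0^Td\lambda\,v\big)[a_\lambda b]^0+\big(\int_0^Td\lambda\,a\big)[v_\lambda b]$; 4. (iv) $v(ab)-a(vb)=\big(\int_{-T}^0[v_\lambda a]\,d\lambda\big)b$; 5. (v) $[v_\lambda ab]=a[v_\lambda b]+[v_\lambda a]b+\int_0^\lambda[[v_\lambda a]_\mu b]^0\,d\mu$;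 6. (vi) $[va_\lambda b]=(e^{T\partial_\lambda}v)[a_\lambda b]+(e^{T\partial_\lambda}a)[v_\lambda b]+\int_0^\lambda[a_\mu[v_{\lambda-\mu}b]]\,d\mu$; 7. (vii) $[a_\lambda vb]=v[a_\lambda b]+[a_\lambda v]b+\int_0^\lambda[[a_\lambda v]_\mu b]\,d\mu$, where $[a_\lambda v]:=-[v_{-\lambda-T}a]$. Here brackets and products are applied coefficientwise, and $\iota_{\mu,\lambda}$ expands powers of $\lambda+\mu$ in nonnegative powers of $\lambda$. The superscript $0$ keeps only integer exponents. $\int_0^\lambda$ sends $\mu^{(k)}$ to $\lambda^{(k+1)}$ for $k\notin\mathbb Z_{<0}$ (and is linear over polynomials in $\lambda$). For a polynomial $p(\lambda)=\sum_j\lambda^jx_j$, $\big(\int_0^Td\lambda\,u\big)p(\lambda)=\sum_j\big(\tfrac{T^{j+1}}{j+1}u\big)\cdot x_j$ and $\int_{-T}^0p(\lambda)\,d\lambda=-\sum_j\tfrac{(-T)^{j+1}}{j+1}x_j$. Finally $(e^{T\partial_\lambda}u)f(\lambda)=\sum_j\big(\tfrac{T^j}{j!}u\big)\cdot\partial_\lambda^jf(\lambda)$.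 -/

import Mathlib

/-!
# Formal series, vertex algebras, modules, intertwining operators

Formal series in one variable with complex exponents and coefficients in `M` are functions
`f : ℂ → M`, where `f n` is the coefficient of the `n`-th power of the variable.  A polynomial with
coefficients in `M` is an element of `ℕ →₀ M`, where `p j` is the coefficient of the `j`-th power.
All vector spaces are over `ℂ`.
-/

noncomputable section

namespace LambdaIntertwiner

/-! ## Spaces of formal series -/

/-- `Γ + ℤ = Γ`, and `Γ / ℤ` is a finite subset of `ℂ / ℤ`. -/
structure IsExponentSet (Γ : Set ℂ) : Prop where
  add_int_mem : ∀ d ∈ Γ, ∀ k : ℤ, d + (k : ℂ) ∈ Γ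
  finite_cosets : ∃ D : Set ℂ, D.Finite ∧ ∀ d ∈ Γ, ∃ e ∈ D, ∃ k : ℤ, d = e + (k : ℂ)

/-- `M[[z]]z^{-Γ}`: the series whose exponents lie in a union of finitely many sets
`-d + ℤ_{≥ 0}` with `d ∈ Γ`. -/
def ZSeries (Γ : Set ℂ) (M : Type*) [AddCommGroup M] [Module ℂ M] : Submodule ℂ (ℂ → M) where
  carrier := {f | ∃ D : Set ℂ, D.Finite ∧ D ⊆ Γ ∧ ∀ n, f n ≠ 0 → ∃ d ∈ D, ∃ k : ℕ, n = -d + k}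
  zero_mem' := ⟨∅, Set.finite_empty, Set.empty_subset _, fun _ h => absurd rfl h⟩
  add_mem' := by
    rintro f g ⟨D, hD, hDΓ, hf⟩ ⟨E, hE, hEΓ, hg⟩
    refine ⟨D ∪ E, hD.union hE, Set.union_subset hDΓ hEΓ, fun n hn => ?_⟩
    by_cases h : f n = 0
    · obtain ⟨d, hd, hk⟩ := hg n (fun h' => hn (by simp [h, h']))
      exact ⟨d, Or.inr hd, hk⟩
    · obtain ⟨d, hd, hk⟩ := hf n h
      exact ⟨d, Or.inl hd, hk⟩
  smul_mem' := by
    rintro c f ⟨D, hD, hDΓ, hf⟩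
    exact ⟨D, hD, hDΓ, fun n hn => hf n (fun h => hn (by simp [h]))⟩

/-- `M[[λ⁻¹]]λ^Γ`: the series whose exponents lie in a union of finitely many sets
`d - ℤ_{≥ 0}` with `d ∈ Γ`. -/
def LambdaSeries (Γ : Set ℂ) (M : Type*) [AddCommGroup M] [Module ℂ M] :
    Submodule ℂ (ℂ → M) where
  carrier := {f | ∃ D : Set ℂ, D.Finite ∧ D ⊆ Γ ∧ ∀ n, f n ≠ 0 → ∃ d ∈ D, ∃ k : ℕ, n = d - k}
  zero_mem' := ⟨∅, Set.finite_empty, Set.empty_subset _, fun _ h => absurd rfl h⟩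
  add_mem' := by
    rintro f g ⟨D, hD, hDΓ, hf⟩ ⟨E, hE, hEΓ, hg⟩
    refine ⟨D ∪ E, hD.union hE, Set.union_subset hDΓ hEΓ, fun n hn => ?_⟩
    by_cases h : f n = 0
    · obtain ⟨d, hd, hk⟩ := hg n (fun h' => hn (by simp [h, h']))
      exact ⟨d, Or.inr hd, hk⟩
    · obtain ⟨d, hd, hk⟩ := hf n h
      exact ⟨d, Or.inl hd, hk⟩
  smul_mem' := by
    rintro c f ⟨D, hD, hDΓ, hf⟩
    exact ⟨D, hD, hDΓ, fun n hn => hf n (fun h => hn (by simp [h]))⟩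

section Series

variable {M N U : Type*} [AddCommGroup M] [Module ℂ M] [AddCommGroup N] [Module ℂ N]
  [AddCommGroup U] [Module ℂ U]

/-- The formal Fourier transform `z^{-n-1} ↦ λ^{(n)} = λ^n / Γ(n+1)`.  At `n ∈ ℤ_{<0}` the
coefficient is zero, because `Complex.Gamma` takes the value `0` at its poles. -/
def fourier (Γ : Set ℂ) : ZSeries Γ M →ₗ[ℂ] LambdaSeries Γ M where
  toFun f := ⟨fun n => (Complex.Gamma (n + 1))⁻¹ • (f : ℂ → M) (-n - 1), by
    obtain ⟨D, hD, hDΓ, hf⟩ := f.2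
    refine ⟨D, hD, hDΓ, fun n hn => ?_⟩
    obtain ⟨d, hd, k, hk⟩ := hf (-n - 1) (fun h => hn (by simp [h]))
    refine ⟨d, hd, k + 1, ?_⟩
    push_cast
    linear_combination -hk⟩
  map_add' f g := by ext n; simp
  map_smul' c f := by ext n; simp [smul_comm c]

/-- Every Laurent series has finitely many coefficients at `z^{-j-1}`, `j ≥ 0`. -/
lemma laurent_finite (f : HahnModule ℤ ℂ M) :
    (Function.support fun j : ℕ =>
      ((j.factorial : ℂ)⁻¹) • ((HahnModule.of ℂ).symm f).coeff (-(j : ℤ) - 1)).Finite := by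
  set g := (HahnModule.of ℂ).symm f
  refine (Set.finite_Iic (-g.order).toNat).subset fun j hj => ?_
  by_contra h
  apply hj
  have h1 : -(j : ℤ) - 1 < g.order := by
    simp only [Set.mem_Iic] at h
    omega
  simp [HahnSeries.coeff_eq_zero_of_lt_order h1]

/-- The formal Fourier transform `M((z)) → M[λ]`: `z^{-j-1} ↦ λ^j / j!` for `j ≥ 0`, and
`z^{-j-1} ↦ 0` for `j < 0`. -/
def fourierLaurent (f : HahnModule ℤ ℂ M) : ℕ →₀ M :=
  Finsupp.ofSupportFinite _ (laurent_finite f)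

lemma lambda_finite (Γ : Set ℂ) (f : LambdaSeries Γ M) :
    (Function.support fun j : ℕ => (f : ℂ → M) (j : ℂ)).Finite := by
  obtain ⟨D, hD, -, hf⟩ := f.2
  obtain ⟨B, hB⟩ := (hD.image Complex.re).bddAbove
  refine (Set.finite_Iic ⌈B⌉₊).subset fun j hj => ?_
  obtain ⟨d, hd, k, hk⟩ := hf j hj
  have h1 : d.re ≤ B := hB ⟨d, hd, rfl⟩
  have h2 := congrArg Complex.re hk
  simp only [Complex.natCast_re, Complex.sub_re] at h2
  have h3 : (j : ℝ) ≤ ⌈B⌉₊ := by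
    have := Nat.le_ceil B
    have : (0 : ℝ) ≤ k := Nat.cast_nonneg k
    linarith
  exact_mod_cast h3

/-- The part `[⋯]⁰` of a series with integer exponents.  It is applied only to series in which no
exponent in `ℤ_{<0}` occurs, where it is a polynomial. -/
def integerPart {Γ : Set ℂ} (f : LambdaSeries Γ M) : ℕ →₀ M :=
  Finsupp.ofSupportFinite _ (lambda_finite Γ f)

/-- A polynomial as a series. -/
def polySeries (p : ℕ →₀ M) : ℂ → M :=
  fun n => p.sum fun j x => if (j : ℂ) = n then x else 0

lemma polySeries_integerPart_zero (Γ : Set ℂ) :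
    polySeries (integerPart (0 : LambdaSeries Γ M)) = 0 := by
  have h : integerPart (0 : LambdaSeries Γ M) = 0 := by
    ext j
    simp [integerPart, Finsupp.ofSupportFinite_coe]
  ext n
  simp [h, polySeries]

/-- The formal derivative of a series. -/
def formalDeriv (f : ℂ → M) : ℂ → M := fun n => (n + 1) • f (n + 1)

/-- Multiplication of a series by the `p`-th power of the variable. -/
def mulPow (p : ℕ) (f : ℂ → M) : ℂ → M := fun n => f (n - p)

open Classical in
/-- `∫₀^λ f(μ) dμ`: `μ^k ↦ λ^{k+1}/(k+1)` (equivalently `μ^{(k)} ↦ λ^{(k+1)}`) for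
`k ∉ ℤ_{<0}`, and `μ^k ↦ 0` for `k ∈ ℤ_{<0}`. -/
def integral (f : ℂ → M) : ℂ → M :=
  fun n => if ∃ k : ℕ, n = -(k : ℂ) then 0 else n⁻¹ • f (n - 1)

/-- `∫₀^λ F(λ, μ) dμ` for a polynomial `F(λ, μ) = ∑_p λ^p F_p(μ)` in `λ` whose coefficients are
series in `μ`. -/
def integralTwo (F : ℕ →₀ (ℂ → M)) : ℂ → M := F.sum fun p f => mulPow p (integral f)

/-- The substitution `ν = λ - μ` in `F(ν, μ) = ∑_i ν^i F_i(μ)`; the result is a polynomial in `λ`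
whose coefficients are series in `μ`. -/
def substSub (F : ℕ →₀ (ℂ → M)) : ℕ →₀ (ℂ → M) :=
  F.sum fun i f => ∑ j ∈ Finset.range (i + 1),
    Finsupp.single (i - j) (((i.choose j : ℂ) * (-1) ^ j) • mulPow j f)

/-- The substitution `ν = λ + μ` in `F(λ, ν) = ∑_j λ^j F_j(ν)`, with
`ι_{μ,λ} (λ+μ)^n = ∑_{i ≥ 0} binom(n, i) λ^i μ^{n-i}`; the value at `m`, `k` is the coefficient of
`λ^m μ^k`. -/
def substAdd (F : ℕ →₀ (ℂ → M)) : ℕ → ℂ → M := fun m k =>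
  ∑ j ∈ Finset.range (m + 1),
    Ring.choose (k + ((m - j : ℕ) : ℂ)) (m - j) • F j (k + ((m - j : ℕ) : ℂ))

/-- `(∫₀^T dλ u) p(λ)`: the polynomial `p(λ) = ∑_j λ^j x_j` is sent to
`∑_j (T^{j+1} u / (j+1)) · x_j`. -/
def integralLeft (T : Module.End ℂ U) (prod : U →ₗ[ℂ] M →ₗ[ℂ] N) (u : U) (p : ℕ →₀ M) : N :=
  p.sum fun j x => ((j : ℂ) + 1)⁻¹ • prod ((T ^ (j + 1)) u) x

/-- `∫_{-T}^0 p(λ) dλ`: `λ^j x` is sent to `-((-T)^{j+1} x) / (j+1)`. -/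
def integralNeg (T : Module.End ℂ M) (p : ℕ →₀ M) : M :=
  p.sum fun j x => -(((j : ℂ) + 1)⁻¹ • ((-T) ^ (j + 1)) x)

/-- `(e^{T∂_λ} u) f(λ) = ∑_j (T^j u / j!) · ∂_λ^j f(λ)`.  For `f` in `LambdaSeries` each coefficient
is a finite sum. -/
def expLeft (T : Module.End ℂ U) (prod : U →ₗ[ℂ] M →ₗ[ℂ] N) (u : U) (f : ℂ → M) : ℂ → N :=
  fun n => ∑ᶠ j : ℕ, (j.factorial : ℂ)⁻¹ • prod ((T ^ j) u) ((formalDeriv^[j] f) n)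

/-- `-p(-λ-T)` for a polynomial `p`, with `T` acting on the coefficients. -/
def skew (T : Module.End ℂ M) (p : ℕ →₀ M) : ℕ →₀ M :=
  -(p.sum fun i x => ∑ j ∈ Finset.range (i + 1),
    Finsupp.single j (((-1 : ℂ) ^ i * (i.choose j : ℂ)) • (T ^ (i - j)) x))

/-- A linear map applied to each coefficient of a polynomial. -/
abbrev mapCoeff (φ : M →ₗ[ℂ] N) (p : ℕ →₀ M) : ℕ →₀ N := Finsupp.mapRange.linearMap φ p

end Series

/-! ## Vertex algebras, modules, intertwining operators -/

/-- The coefficients of `z₁^{-m-1} z₂^{-k-1}` on both sides of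
`ι_{z₁,z₂} (z₁-z₂)^n Y(v,z₁) 𝒴(a,z₂) b - ι_{z₂,z₁} (z₁-z₂)^n 𝒴(a,z₂) Y(v,z₁) b
  = ∑_{i ≥ 0} 𝒴(v_{(n+i)} a, z₂) b ∂_{z₂}^{(i)} δ(z₁,z₂)`
agree, for all integers `n`, `m` and all `k` in `K` (which is `ℤ` or `ℂ`).  Here `vA`, `vB`, `vC`
are the modes of `v` on the spaces of `a`, of `b` and of the values, and `mode a k b` is
`a_{(k)} b`. -/
def BorcherdsIdentity {K A B C : Type*} [Ring K] [AddCommGroup C]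
    (vA : ℤ → A → A) (vB : ℤ → B → B) (vC : ℤ → C → C) (mode : A → K → B → C)
    (a : A) (b : B) : Prop :=
  ∀ (n m : ℤ) (k : K),
    ∑ᶠ j : ℕ, ((-1) ^ j * Ring.choose n j) •
        (vC (m + n - j) (mode a (k + j) b)
          - (n.negOnePow : ℤ) • mode a ((n : K) + k - j) (vB (m + j) b))
      = ∑ᶠ j : ℕ, Ring.choose m j • mode (vA (n + j) a) ((m : K) + k - j) b

/-- A vertex algebra structure on `V`. -/
structure VertexAlgebra (V : Type*) [AddCommGroup V] [Module ℂ V] where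
  vac : V
  Y : V →ₗ[ℂ] VertexOperator ℂ V
  vac_mode : ∀ (n : ℤ) (u : V), (Y vac).ncoeff n u = if n = -1 then u else 0
  mode_vac_nonneg : ∀ (v : V) (n : ℤ), 0 ≤ n → (Y v).ncoeff n vac = 0
  mode_vac_neg_one : ∀ v : V, (Y v).ncoeff (-1) vac = v
  borcherds : ∀ v u w : V, BorcherdsIdentity (K := ℤ)
    (fun n x => (Y v).ncoeff n x) (fun n x => (Y v).ncoeff n x) (fun n x => (Y v).ncoeff n x)
    (fun x n y => (Y x).ncoeff n y) u w

/-- `v_{(n)} u`. -/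
def VertexAlgebra.mode {V : Type*} [AddCommGroup V] [Module ℂ V] (A : VertexAlgebra V) (n : ℤ) :
    V →ₗ[ℂ] V →ₗ[ℂ] V :=
  LinearMap.proj n ∘ₗ VertexOperator.ncoeff ∘ₗ A.Y

/-- The translation operator `T v = v_{(-2)} |0⟩`. -/
def VertexAlgebra.T {V : Type*} [AddCommGroup V] [Module ℂ V] (A : VertexAlgebra V) :
    Module.End ℂ V :=
  (A.mode (-2)).flip A.vac

/-- The structure of a module over the vertex algebra `A` on `M`. -/
structure VertexModule {V : Type*} [AddCommGroup V] [Module ℂ V] (A : VertexAlgebra V)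
    (M : Type*) [AddCommGroup M] [Module ℂ M] where
  T : Module.End ℂ M
  Y : V →ₗ[ℂ] VertexOperator ℂ M
  vac_mode : ∀ (n : ℤ) (x : M), (Y A.vac).ncoeff n x = if n = -1 then x else 0
  translation : ∀ (v : V) (n : ℤ) (x : M),
    T ((Y v).ncoeff n x) - (Y v).ncoeff n (T x) = -n • (Y v).ncoeff (n - 1) x
  borcherds : ∀ (v u : V) (x : M), BorcherdsIdentity (K := ℤ)
    (fun n w => A.mode n v w) (fun n y => (Y v).ncoeff n y) (fun n y => (Y v).ncoeff n y)
    (fun w n y => (Y w).ncoeff n y) u x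

section Modules

variable {V : Type*} [AddCommGroup V] [Module ℂ V] {A : VertexAlgebra V}
  {M : Type*} [AddCommGroup M] [Module ℂ M]

/-- `v_{(n)} x` for `v ∈ V`, `x ∈ M`. -/
def VertexModule.mode (W : VertexModule A M) (n : ℤ) : V →ₗ[ℂ] M →ₗ[ℂ] M :=
  LinearMap.proj n ∘ₗ VertexOperator.ncoeff ∘ₗ W.Y

/-- The product `v · x = v_{(-1)} x`. -/
def VertexModule.product (W : VertexModule A M) : V →ₗ[ℂ] M →ₗ[ℂ] M := W.mode (-1)

/-- The `λ`-bracket `[v_λ x]`, the Fourier transform of `Y(v,z)x`, a polynomial in `λ`. -/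
def VertexModule.bracket (W : VertexModule A M) (v : V) (x : M) : ℕ →₀ M :=
  fourierLaurent (W.Y v x)

end Modules

section Intertwiners

variable {V M₁ M₂ M₃ : Type*} [AddCommGroup V] [Module ℂ V] [AddCommGroup M₁] [Module ℂ M₁]
  [AddCommGroup M₂] [Module ℂ M₂] [AddCommGroup M₃] [Module ℂ M₃] {A : VertexAlgebra V}

/-- Intertwining operators of type `(M₃; M₁ M₂)` with values in `M₃[[z]]z^{-Γ}`. -/
structure IntertwiningOperator (Γ : Set ℂ) (W₁ : VertexModule A M₁) (W₂ : VertexModule A M₂)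
    (W₃ : VertexModule A M₃) where
  Y : M₁ →ₗ[ℂ] M₂ →ₗ[ℂ] ZSeries Γ M₃
  /-- `[T, 𝒴(a,z)] b = 𝒴(Ta,z) b` -/
  commutator_T : ∀ (a : M₁) (b : M₂) (n : ℂ),
    W₃.T ((Y a b : ℂ → M₃) n) - (Y a (W₂.T b) : ℂ → M₃) n = (Y (W₁.T a) b : ℂ → M₃) n
  /-- `𝒴(Ta,z) b = ∂_z 𝒴(a,z) b` -/
  translation : ∀ (a : M₁) (b : M₂), (Y (W₁.T a) b : ℂ → M₃) = formalDeriv (Y a b : ℂ → M₃)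
  borcherds : ∀ (v : V) (a : M₁) (b : M₂), BorcherdsIdentity (K := ℂ)
    (fun n x => W₁.mode n v x) (fun n x => W₂.mode n v x) (fun n x => W₃.mode n v x)
    (fun x n y => (Y x y : ℂ → M₃) (-n - 1)) a b

/-- The `λ`-bracket `[a_λ b] = F_z^λ (𝒴(a,z) b)`. -/
def IntertwiningOperator.bracket {Γ : Set ℂ} {W₁ : VertexModule A M₁} {W₂ : VertexModule A M₂}
    {W₃ : VertexModule A M₃} (I : IntertwiningOperator Γ W₁ W₂ W₃) :
    M₁ →ₗ[ℂ] M₂ →ₗ[ℂ] LambdaSeries Γ M₃ :=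
  I.Y.compr₂ (fourier Γ)

/-- The product `a · b = a_{(-1)} b`, the coefficient of `z^0` in `𝒴(a,z) b`. -/
def IntertwiningOperator.product {Γ : Set ℂ} {W₁ : VertexModule A M₁} {W₂ : VertexModule A M₂}
    {W₃ : VertexModule A M₃} (I : IntertwiningOperator Γ W₁ W₂ W₃) :
    M₁ →ₗ[ℂ] M₂ →ₗ[ℂ] M₃ :=
  I.Y.compr₂ (LinearMap.proj (0 : ℂ) ∘ₗ (ZSeries Γ M₃).subtype)

/-- The conditions on a `λ`-bracket `br a b = [a_λ b]` and a product `pr a b = a · b`.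
For `v ∈ V` the brackets `[v_λ x]` and products `v · x` are those of the modules. -/
structure IsBracketProduct {Γ : Set ℂ} (W₁ : VertexModule A M₁) (W₂ : VertexModule A M₂)
    (W₃ : VertexModule A M₃) (br : M₁ →ₗ[ℂ] M₂ →ₗ[ℂ] LambdaSeries Γ M₃)
    (pr : M₁ →ₗ[ℂ] M₂ →ₗ[ℂ] M₃) : Prop where
  /-- `[a_λ b] = ∑_{n ∈ ℂ - ℤ_{<0}} λ^{(n)} c_{(n)}` -/
  no_negative : ∀ (a : M₁) (b : M₂) (n : ℕ), (br a b : ℂ → M₃) (-((n : ℂ) + 1)) = 0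
  /-- The exponents of the series with constant term `a · b` have to lie in `-Γ`: no condition if
  `0 ∈ Γ`. -/
  product_eq_zero : (0 : ℂ) ∉ Γ → pr = 0
  /-- `[Ta_λ b] = -λ [a_λ b]` -/
  sesquilinear_left : ∀ (a : M₁) (b : M₂),
    (br (W₁.T a) b : ℂ → M₃) = -mulPow 1 (br a b : ℂ → M₃)
  /-- `[a_λ Tb] = (λ + T) [a_λ b]` -/
  sesquilinear_right : ∀ (a : M₁) (b : M₂),
    (br a (W₂.T b) : ℂ → M₃)
      = mulPow 1 (br a b : ℂ → M₃) + fun n => W₃.T ((br a b : ℂ → M₃) n)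
  /-- `[v_λ [a_μ b]] = [a_μ [v_λ b]] + ι_{μ,λ} [[v_λ a]_{λ+μ} b]`, coefficient of `λ^m μ^k` -/
  jacobi : ∀ (v : V) (a : M₁) (b : M₂) (m : ℕ) (k : ℂ),
    W₃.bracket v ((br a b : ℂ → M₃) k) m
      = (br a (W₂.bracket v b m) : ℂ → M₃) k
        + substAdd (mapCoeff ((LambdaSeries Γ M₃).subtype ∘ₗ br.flip b) (W₁.bracket v a)) m k
  /-- `T (a · b) = Ta · b + a · Tb` -/
  derivation : ∀ (a : M₁) (b : M₂), W₃.T (pr a b) = pr (W₁.T a) b + pr a (W₂.T b)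
  /-- `(va)b - v(ab) = (∫₀^T dλ v) [a_λ b]⁰ + (∫₀^T dλ a) [v_λ b]` -/
  quasi_assoc : ∀ (v : V) (a : M₁) (b : M₂),
    pr (W₁.product v a) b - W₃.product v (pr a b)
      = integralLeft A.T W₃.product v (integerPart (br a b))
        + integralLeft W₁.T pr a (W₂.bracket v b)
  /-- `v(ab) - a(vb) = (∫_{-T}^0 [v_λ a] dλ) b` -/
  quasi_comm : ∀ (v : V) (a : M₁) (b : M₂),
    W₃.product v (pr a b) - pr a (W₂.product v b)
      = pr (integralNeg W₁.T (W₁.bracket v a)) b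
  /-- `[v_λ ab] = a[v_λ b] + [v_λ a]b + ∫₀^λ [[v_λ a]_μ b]⁰ dμ` -/
  wick_product : ∀ (v : V) (a : M₁) (b : M₂),
    polySeries (W₃.bracket v (pr a b))
      = polySeries (mapCoeff (pr a) (W₂.bracket v b))
        + polySeries (mapCoeff (pr.flip b) (W₁.bracket v a))
        + integralTwo ((W₁.bracket v a).mapRange
            (fun x => polySeries (integerPart (br x b)))
            (by rw [map_zero, LinearMap.zero_apply]; exact polySeries_integerPart_zero Γ))
  /-- `[va_λ b] = (e^{T∂_λ} v)[a_λ b] + (e^{T∂_λ} a)[v_λ b] + ∫₀^λ [a_μ [v_{λ-μ} b]] dμ` -/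
  wick_left : ∀ (v : V) (a : M₁) (b : M₂),
    (br (W₁.product v a) b : ℂ → M₃)
      = expLeft A.T W₃.product v (br a b : ℂ → M₃)
        + expLeft W₁.T pr a (polySeries (W₂.bracket v b))
        + integralTwo (substSub
            (mapCoeff ((LambdaSeries Γ M₃).subtype ∘ₗ br a) (W₂.bracket v b)))
  /-- `[a_λ vb] = v[a_λ b] + [a_λ v]b + ∫₀^λ [[a_λ v]_μ b] dμ`, where
  `[a_λ v] = -[v_{-λ-T} a]` -/
  wick_right : ∀ (v : V) (a : M₁) (b : M₂),
    (br a (W₂.product v b) : ℂ → M₃)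
      = (fun n => W₃.product v ((br a b : ℂ → M₃) n))
        + polySeries (mapCoeff (pr.flip b) (skew W₁.T (W₁.bracket v a)))
        + integralTwo (mapCoeff ((LambdaSeries Γ M₃).subtype ∘ₗ br.flip b)
            (skew W₁.T (W₁.bracket v a)))

end Intertwiners

end LambdaIntertwiner

end

noncomputable section

set_option linter.unusedSectionVars false

namespace LambdaIntertwiner

/-! ## Binomial sums -/

/-! Write `c a b k` for a_(k) b. The proof studies the difference of the two sides of the Borcherds
identity, `borcherdsDefect`, as a function of v, a, b and of the indices (n, m, k).

Each of the conditions (ii)–(vii) says that this defect vanishes on one family of indices. Up to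
nonzero scalars, with k ∉ ℤ_{<0} where k is free: Jacobi is (0, m ≥ 0, k), the Wick formula for [v_λ
ab] is (0, m ≥ 0, -1), the right Wick formula is (0, -1, k), quasi-commutativity is (0, -1, -1), the
left Wick formula is (-1, 0, k), and quasi-associativity is (-1, 0, -1). These are the lemmas
`jacobi_sub`, `wick_product_sub`, `wick_right_sub`, `quasi_comm_sub`, `wick_left_sub` and
`quasi_assoc_sub`. In divided powers λ^{(n)} the formal operations become index shifts, so they are
comparisons of coefficients. An intertwining operator therefore satisfies all the conditions.

Conversely, translation covariance determines every mode: the bracket gives a_(k) b for k ∉ ℤ_{<0},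
because 1/Γ(k+1) ≠ 0 there, and a_(-i-1) b = (T^i a / i!) · b. This gives injectivity, and it is the
definition of the inverse (`modeOf`). Condition (i) and the derivation rule then give the two
translation axioms.

It remains to pass from the six families of indices to all of them. The defect obeys three
recursions: multiplication by z₁ - z₂ relates n + 1 to n, and replacing v by Tv or a by Ta acts as a
derivative in z₁ or z₂. By `eq_zero_of_recursion` a family with these recursions that vanishes on
the six families, for all v, a and b, is zero. -/

lemma succ_mul_choose_succ {R : Type*} [CommRing R] [BinomialRing R] (x : R) (j : ℕ) :
    ((j : R) + 1) * Ring.choose x (j + 1) = x * Ring.choose (x - 1) j := by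
  have h1 := Ring.descPochhammer_eq_factorial_smul_choose x (j + 1)
  have h2 := Ring.descPochhammer_eq_factorial_smul_choose (x - 1) j
  rw [descPochhammer_succ_left, Polynomial.smeval_mul, Polynomial.smeval_X,
    Polynomial.smeval_comp] at h1
  simp only [Polynomial.smeval_sub, Polynomial.smeval_X, Polynomial.smeval_one, pow_one, pow_zero,
    one_smul] at h1
  rw [h2] at h1
  -- A binomial ring has no additive torsion, so the identity may be checked after multiplication by
  -- `j!`, where it is the recursion of falling factorials.
  apply BinomialRing.toIsAddTorsionFree.nsmul_right_injective (Nat.factorial_ne_zero j)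
  simp only [nsmul_eq_mul] at h1 ⊢
  rw [Nat.factorial_succ] at h1
  push_cast at h1
  linear_combination -h1

lemma sub_mul_choose {R : Type*} [CommRing R] [BinomialRing R] (x : R) (j : ℕ) :
    (x - j) * Ring.choose x j = x * Ring.choose (x - 1) j := by
  rw [← succ_mul_choose_succ]
  have h := Ring.choose_succ_succ (x - 1) j
  rw [sub_add_cancel] at h
  have h1 := succ_mul_choose_succ x j
  cases j with
  | zero => simp
  | succ i =>
    have h2 := succ_mul_choose_succ x i
    have h3 := Ring.choose_succ_succ (x - 1) i
    rw [sub_add_cancel] at h3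
    rw [h1]
    push_cast
    linear_combination x * h3 - h2

/-- All but finitely many terms of the sequence vanish. -/
def EventuallyZero {C : Type*} [Zero C] (F : ℕ → C) : Prop := ∃ N : ℕ, ∀ j ≥ N, F j = 0


section Sums

variable {C : Type*} [AddCommGroup C] [Module ℂ C]

lemma EventuallyZero.add {F G : ℕ → C} (hF : EventuallyZero F) (hG : EventuallyZero G) :
    EventuallyZero (fun j => F j + G j) := by
  obtain ⟨N, hN⟩ := hF
  obtain ⟨K, hK⟩ := hG
  exact ⟨max N K, fun j hj => by
    beta_reduce
    rw [hN j (le_trans (le_max_left _ _) hj), hK j (le_trans (le_max_right _ _) hj), add_zero]⟩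

lemma EventuallyZero.smul {F : ℕ → C} (hF : EventuallyZero F) (g : ℕ → ℂ) :
    EventuallyZero (fun j => g j • F j) := by
  obtain ⟨N, hN⟩ := hF
  exact ⟨N, fun j hj => by simp only [hN j hj, smul_zero]⟩

lemma EventuallyZero.succ {F : ℕ → C} (hF : EventuallyZero F) :
    EventuallyZero (fun j => F (j + 1)) := by
  obtain ⟨N, hN⟩ := hF
  exact ⟨N, fun j hj => hN _ (by omega)⟩

lemma EventuallyZero.finite_support {F : ℕ → C} (hF : EventuallyZero F) :
    (Function.support F).Finite := by
  obtain ⟨N, hN⟩ := hF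
  refine (Set.finite_lt_nat N).subset fun j hj => ?_
  by_contra h
  exact hj (hN j (not_lt.1 h))

lemma finsum_eq_sum_range {F : ℕ → C} {N : ℕ} (hN : ∀ j ≥ N, F j = 0) :
    ∑ᶠ j, F j = ∑ j ∈ Finset.range N, F j := by
  apply finsum_eq_sum_of_support_subset
  intro j hj
  simp only [Finset.coe_range, Set.mem_Iio]
  by_contra h
  exact hj (hN j (not_lt.1 h))

/-- `∑_{j ≥ 0} binom(n, j) F_j`. -/
def binomSum (n : ℤ) (F : ℕ → C) : C := ∑ᶠ j : ℕ, ((Ring.choose n j : ℤ) : ℂ) • F j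

lemma binomSum_eq_sum (n : ℤ) {F : ℕ → C} {N : ℕ} (hN : ∀ j ≥ N, F j = 0) :
    binomSum n F = ∑ j ∈ Finset.range N, ((Ring.choose n j : ℤ) : ℂ) • F j :=
  finsum_eq_sum_range fun j hj => by rw [hN j hj, smul_zero]

lemma binomSum_add (n : ℤ) {F G : ℕ → C} (hF : EventuallyZero F) (hG : EventuallyZero G) :
    binomSum n (fun j => F j + G j) = binomSum n F + binomSum n G := by
  unfold binomSum
  rw [← finsum_add_distrib (hF.smul _).finite_support (hG.smul _).finite_support]
  simp only [smul_add]

lemma binomSum_smul (n : ℤ) (c : ℂ) (F : ℕ → C) :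
    binomSum n (fun j => c • F j) = c • binomSum n F := by
  unfold binomSum
  rw [smul_finsum]
  simp only [smul_comm c]

lemma binomSum_zero_left (F : ℕ → C) : binomSum 0 F = F 0 := by
  unfold binomSum
  rw [finsum_eq_single _ 0]
  · simp
  · intro j hj
    obtain ⟨i, rfl⟩ := Nat.exists_eq_succ_of_ne_zero hj
    simp [Ring.choose_zero_succ]

lemma binomSum_natCast (m : ℕ) (F : ℕ → C) :
    binomSum (m : ℤ) F = ∑ j ∈ Finset.range (m + 1), (m.choose j : ℂ) • F j := by
  unfold binomSum
  rw [finsum_eq_sum_range (N := m + 1)]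
  · simp [Ring.choose_natCast]
  · intro j hj
    simp [Ring.choose_natCast, Nat.choose_eq_zero_of_lt (show m < j by omega)]

lemma choose_neg_one (j : ℕ) : Ring.choose (-1 : ℤ) j = (-1) ^ j := by
  induction j with
  | zero => simp
  | succ j ih =>
    have h := Ring.choose_succ_succ (-1 : ℤ) j
    rw [neg_add_cancel, Ring.choose_zero_succ, ih] at h
    rw [pow_succ]
    linarith

lemma binomSum_neg_one (F : ℕ → C) : binomSum (-1) F = ∑ᶠ j : ℕ, (-1 : ℂ) ^ j • F j := by
  simp [binomSum, choose_neg_one]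

/-- If S is the shift of sequences, `binomSum n F` is the value at 0 of (1 + S)^n F, and Pascal's
rule is (1 + S)^{n+1} = (1 + S)^n (1 + S). Eventual vanishing keeps the sums finite for negative n.
-/
lemma binomSum_succ (n : ℤ) {F : ℕ → C} (hF : EventuallyZero F) :
    binomSum (n + 1) F = binomSum n F + binomSum n (fun j => F (j + 1)) := by
  obtain ⟨N, hN⟩ := hF
  have hN' : ∀ j ≥ N + 1, F j = 0 := fun j hj => hN j (by omega)
  have h1 : ∀ j ≥ N, F (j + 1) = 0 := fun j hj => hN _ (by omega)
  rw [binomSum_eq_sum _ hN', binomSum_eq_sum _ hN', binomSum_eq_sum _ h1, Finset.sum_range_succ',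
    Finset.sum_range_succ']
  have h2 : ∀ j : ℕ, ((Ring.choose (n + 1) (j + 1) : ℤ) : ℂ) • F (j + 1)
      = ((Ring.choose n (j + 1) : ℤ) : ℂ) • F (j + 1)
        + ((Ring.choose n j : ℤ) : ℂ) • F (j + 1) := by
    intro j
    rw [Ring.choose_succ_succ, ← add_smul]
    push_cast
    rw [add_comm]
  simp only [h2, Finset.sum_add_distrib, Ring.choose_zero_right]
  abel

/-- Absorption j·binom(n, j) = n·binom(n-1, j-1). Weights linear in j appear because a translation
multiplies a mode by its own index. -/
lemma binomSum_index_smul (n : ℤ) {F : ℕ → C} (hF : EventuallyZero F) :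
    binomSum n (fun j => (j : ℂ) • F j) = (n : ℂ) • binomSum (n - 1) (fun j => F (j + 1)) := by
  obtain ⟨N, hN⟩ := hF
  have hN' : ∀ j ≥ N + 1, (j : ℂ) • F j = 0 := fun j hj => by rw [hN j (by omega), smul_zero]
  have h1 : ∀ j ≥ N, F (j + 1) = 0 := fun j hj => hN _ (by omega)
  rw [binomSum_eq_sum _ hN', binomSum_eq_sum _ h1, Finset.sum_range_succ', Finset.smul_sum]
  simp only [Nat.cast_zero, zero_smul, smul_zero, add_zero]
  refine Finset.sum_congr rfl fun j _ => ?_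
  rw [smul_smul, smul_smul]
  congr 1
  have := congrArg (Int.cast : ℤ → ℂ) (succ_mul_choose_succ n j)
  push_cast at this ⊢
  rw [← this]
  ring

lemma binomSum_sub_index_smul (n : ℤ) (F : ℕ → C) :
    binomSum n (fun j => ((n : ℂ) - j) • F j) = (n : ℂ) • binomSum (n - 1) F := by
  unfold binomSum
  rw [smul_finsum]
  refine finsum_congr fun j => ?_
  rw [smul_smul, smul_smul]
  congr 1
  have := congrArg (Int.cast : ℤ → ℂ) (sub_mul_choose n j)
  push_cast at this ⊢
  rw [← this]
  ring

lemma binomSum_linear_index (n : ℤ) {F G H : ℕ → C} (a : ℂ) (hG : EventuallyZero G)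
    (hH : EventuallyZero H) (h : ∀ j, F j = a • H j + (j : ℂ) • G j) :
    binomSum n F = a • binomSum n H + (n : ℂ) • binomSum (n - 1) (fun j => G (j + 1)) := by
  rw [← binomSum_index_smul n hG, ← binomSum_smul, ← binomSum_add n (hH.smul _) (hG.smul _)]
  exact congrArg _ (funext h)

lemma binomSum_linear_sub_index (n : ℤ) {F G H : ℕ → C} (a : ℂ) (hG : EventuallyZero G)
    (hH : EventuallyZero H) (h : ∀ j, F j = a • H j + ((n : ℂ) - j) • G j) :
    binomSum n F = a • binomSum n H + (n : ℂ) • binomSum (n - 1) G := by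
  rw [← binomSum_sub_index_smul n G, ← binomSum_smul, ← binomSum_add n (hH.smul _) (hG.smul _)]
  exact congrArg _ (funext h)

/-! ## The three sums in the Borcherds identity -/

/-- The coefficient of `ι_{z₁,z₂} (z₁-z₂)^n P(z₁,z₂)`. -/
def leftSum (P : ℤ → ℂ → C) (n m : ℤ) (k : ℂ) : C :=
  binomSum n fun j => (-1 : ℂ) ^ j • P (m + n - j) (k + j)

/-- The coefficient of `ι_{z₂,z₁} (z₁-z₂)^n Q(z₂,z₁)`. -/
def rightSum (Q : ℂ → ℤ → C) (n m : ℤ) (k : ℂ) : C :=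
  ((n.negOnePow : ℤ) : ℂ) • binomSum n fun j => (-1 : ℂ) ^ j • Q (n + k - j) (m + j)

/-- The coefficient of `∑_i R_{n+i}(z₂) ∂_{z₂}^{(i)} δ(z₁,z₂)`. -/
def deltaSum (R : ℤ → ℂ → C) (n m : ℤ) (k : ℂ) : C :=
  binomSum m fun j => R (n + j) (m + k - j)

/-- `P(s, t + j)` vanishes for `j` large. -/
def LeftBounded (P : ℤ → ℂ → C) : Prop := ∀ t : ℂ, ∃ N : ℕ, ∀ j ≥ N, ∀ s, P s (t + (j : ℕ)) = 0

/-- `Q(t, s + j)` vanishes for `j` large. -/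
def RightBounded (Q : ℂ → ℤ → C) : Prop := ∀ s : ℤ, ∃ N : ℕ, ∀ j ≥ N, ∀ t, Q t (s + (j : ℕ)) = 0

/-- `R(s + j, t)` vanishes for `j` large. -/
def DeltaBounded (R : ℤ → ℂ → C) : Prop := ∀ s : ℤ, ∃ N : ℕ, ∀ j ≥ N, ∀ t, R (s + (j : ℕ)) t = 0

lemma LeftBounded.eventuallyZero {P : ℤ → ℂ → C} (hP : LeftBounded P) (s : ℕ → ℤ) (k : ℂ)
    (g : ℕ → ℂ) : EventuallyZero fun j => g j • P (s j) (k + j) := by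
  obtain ⟨N, hN⟩ := hP k
  exact ⟨N, fun j hj => by simp only [hN j hj, smul_zero]⟩

lemma RightBounded.eventuallyZero {Q : ℂ → ℤ → C} (hQ : RightBounded Q) (t : ℕ → ℂ) (m : ℤ)
    (g : ℕ → ℂ) : EventuallyZero fun j => g j • Q (t j) (m + j) := by
  obtain ⟨N, hN⟩ := hQ m
  exact ⟨N, fun j hj => by simp only [hN j hj, smul_zero]⟩

lemma DeltaBounded.eventuallyZero {R : ℤ → ℂ → C} (hR : DeltaBounded R) (n : ℤ) (t : ℕ → ℂ) :
    EventuallyZero fun j => R (n + j) (t j) := by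
  obtain ⟨N, hN⟩ := hR n
  exact ⟨N, fun j hj => hN j hj _⟩

/-- One factor z₁ - z₂ is split off from (z₁ - z₂)^{n+1}: multiplication by z₁ raises m,
multiplication by z₂ raises k. -/
lemma leftSum_succ {P : ℤ → ℂ → C} (hP : LeftBounded P) (n m : ℤ) (k : ℂ) :
    leftSum P (n + 1) m k = leftSum P n (m + 1) k - leftSum P n m (k + 1) := by
  unfold leftSum
  rw [binomSum_succ _ (hP.eventuallyZero _ k _), sub_eq_add_neg, ← neg_one_smul ℂ (binomSum n _),
    ← binomSum_smul]
  congr 2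
  · ext j; congr 2; ring
  · ext j
    rw [pow_succ, smul_smul, mul_comm]
    congr 2 <;> (push_cast; ring)

lemma rightSum_succ {Q : ℂ → ℤ → C} (hQ : RightBounded Q) (n m : ℤ) (k : ℂ) :
    rightSum Q (n + 1) m k = rightSum Q n (m + 1) k - rightSum Q n m (k + 1) := by
  unfold rightSum
  rw [binomSum_succ _ (hQ.eventuallyZero _ m _), Int.negOnePow_succ, smul_add, add_comm,
    sub_eq_add_neg, ← smul_neg]
  push_cast
  rw [neg_smul, neg_smul, ← smul_neg, ← smul_neg]
  congr 2
  · rw [← neg_one_smul ℂ, ← binomSum_smul]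
    congr 1
    ext j
    rw [pow_succ, smul_smul]
    congr 2 <;> ring
  · congr 2
    ext j
    congr 2
    ring

/-- Here the binomial coefficients have upper index m, so Pascal's rule expands the term at m + 1
instead of the one at n + 1. -/
lemma deltaSum_succ {R : ℤ → ℂ → C} (hR : DeltaBounded R) (n m : ℤ) (k : ℂ) :
    deltaSum R (n + 1) m k = deltaSum R n (m + 1) k - deltaSum R n m (k + 1) := by
  unfold deltaSum
  rw [binomSum_succ m (hR.eventuallyZero n fun j => ((m + 1 : ℤ) : ℂ) + k - j)]
  have h1 : ∀ j : ℕ, R (n + j) ((m + 1 : ℤ) + k - j) = R (n + j) (m + (k + 1) - j) := by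
    intro j; congr 1; push_cast; ring
  have h2 : ∀ j : ℕ, R (n + (j + 1 : ℕ)) (m + (k + 1) - (j + 1 : ℕ))
      = R (n + 1 + j) (m + k - j) := by
    intro j; congr 1 <;> (push_cast; ring)
  simp only [h1, h2]
  abel

/-- Leibniz rule: (z₁ - z₂)^n ∂₁P = ∂₁((z₁ - z₂)^n P) - n (z₁ - z₂)^{n-1} P. On coefficients this is
the splitting m + n - j = m + (n - j). The other translation lemmas follow the same pattern, with +n
for ∂₂. -/
lemma leftSum_translation_left {P P' : ℤ → ℂ → C} (hP : LeftBounded P)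
    (h : ∀ s t, P' s t = (-s : ℂ) • P (s - 1) t) (n m : ℤ) (k : ℂ) :
    leftSum P' n m k = (-m : ℂ) • leftSum P n (m - 1) k - (n : ℂ) • leftSum P (n - 1) m k := by
  unfold leftSum
  rw [binomSum_linear_sub_index n (-m : ℂ)
    (G := fun j => (-(-1 : ℂ) ^ j) • P (m + (n - 1) - j) (k + j))
    (hP.eventuallyZero _ k _) (hP.eventuallyZero (fun j => m - 1 + n - j) k fun j => (-1 : ℂ) ^ j)]
  · simp only [neg_smul, binomSum, smul_neg, finsum_neg_distrib]
    abel
  · intro j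
    rw [h, show m - 1 + n - (j : ℤ) = m + n - j - 1 by ring,
      show m + (n - 1) - (j : ℤ) = m + n - j - 1 by ring]
    push_cast
    module

lemma leftSum_translation_right {P P' : ℤ → ℂ → C} (hP : LeftBounded P)
    (h : ∀ s t, P' s t = (-t : ℂ) • P s (t - 1)) (n m : ℤ) (k : ℂ) :
    leftSum P' n m k = (-k : ℂ) • leftSum P n m (k - 1) + (n : ℂ) • leftSum P (n - 1) m k := by
  unfold leftSum
  rw [binomSum_linear_index n (-k : ℂ)
    (G := fun j => (-(-1 : ℂ) ^ j) • P (m + n - j) (k - 1 + j))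
    (hP.eventuallyZero _ _ _) (hP.eventuallyZero (fun j => m + n - j) (k - 1) fun j => (-1 : ℂ) ^ j)]
  · congr 4
    ext j
    rw [pow_succ]
    congr 2 <;> (push_cast; ring)
  · intro j
    rw [h, show k - 1 + (j : ℂ) = k + j - 1 by ring]
    module

lemma rightSum_translation_left {Q Q' : ℂ → ℤ → C} (hQ : RightBounded Q)
    (h : ∀ t s, Q' t s = (-s : ℂ) • Q t (s - 1)) (n m : ℤ) (k : ℂ) :
    rightSum Q' n m k = (-m : ℂ) • rightSum Q n (m - 1) k - (n : ℂ) • rightSum Q (n - 1) m k := by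
  unfold rightSum
  rw [binomSum_linear_index n (-m : ℂ)
    (G := fun j => (-(-1 : ℂ) ^ j) • Q (n + k - j) (m - 1 + j))
    (hQ.eventuallyZero _ _ _) (hQ.eventuallyZero (fun j => n + k - j) (m - 1) fun j => (-1 : ℂ) ^ j)]
  · rw [Int.negOnePow_sub, Int.negOnePow_one]
    have h1 : ∀ j : ℕ, (-(-1 : ℂ) ^ (j + 1)) • Q (n + k - (j + 1 : ℕ)) (m - 1 + (j + 1 : ℕ))
        = (-1 : ℂ) ^ j • Q ((n - 1 : ℤ) + k - j) (m + j) := by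
      intro j
      rw [pow_succ]
      congr 2 <;> (push_cast; ring)
    simp only [h1]
    push_cast
    module
  · intro j
    rw [h, show m - 1 + (j : ℤ) = m + j - 1 by ring]
    push_cast
    module

lemma rightSum_translation_right {Q Q' : ℂ → ℤ → C} (hQ : RightBounded Q)
    (h : ∀ t s, Q' t s = (-t : ℂ) • Q (t - 1) s) (n m : ℤ) (k : ℂ) :
    rightSum Q' n m k = (-k : ℂ) • rightSum Q n m (k - 1) + (n : ℂ) • rightSum Q (n - 1) m k := by
  unfold rightSum
  rw [binomSum_linear_sub_index n (-k : ℂ)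
    (G := fun j => (-1 : ℂ) • (-1 : ℂ) ^ j • Q ((n - 1 : ℤ) + k - j) (m + j))
    ((hQ.eventuallyZero _ _ _).smul _)
    (hQ.eventuallyZero (fun j => n + (k - 1) - j) m fun j => (-1 : ℂ) ^ j)]
  · rw [Int.negOnePow_sub, Int.negOnePow_one, binomSum_smul]
    push_cast
    module
  · intro j
    rw [h, show (n : ℂ) + (k - 1) - j = n + k - j - 1 by ring,
      show ((n - 1 : ℤ) : ℂ) + k - j = n + k - j - 1 by push_cast; ring]
    module

lemma deltaSum_translation_left {R R' : ℤ → ℂ → C} (hR : DeltaBounded R)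
    (h : ∀ s t, R' s t = (-s : ℂ) • R (s - 1) t) (n m : ℤ) (k : ℂ) :
    deltaSum R' n m k = (-m : ℂ) • deltaSum R n (m - 1) k - (n : ℂ) • deltaSum R (n - 1) m k := by
  unfold deltaSum
  rw [binomSum_linear_index m (-n : ℂ)
    (G := fun j => (-1 : ℂ) • R (n - 1 + j) (m + k - j))
    ((hR.eventuallyZero _ _).smul _) (hR.eventuallyZero (n - 1) fun j => m + k - j)]
  · have h1 : ∀ j : ℕ, R (n - 1 + (j + 1 : ℕ)) (m + k - (j + 1 : ℕ))
        = R (n + j) ((m - 1 : ℤ) + k - j) := by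
      intro j
      congr 1 <;> (push_cast; ring)
    simp only [h1, binomSum_smul]
    module
  · intro j
    rw [h, show n - 1 + (j : ℤ) = n + j - 1 by ring]
    push_cast
    module

/-- The second term of `h` comes from v_(s)(Ta) = T(v_(s)a) + s v_(s-1)a. -/
lemma deltaSum_translation_right {R R' : ℤ → ℂ → C} (hR : DeltaBounded R)
    (h : ∀ s t, R' s t = (-t : ℂ) • R s (t - 1) + (s : ℂ) • R (s - 1) t) (n m : ℤ) (k : ℂ) :
    deltaSum R' n m k = (-k : ℂ) • deltaSum R n m (k - 1) + (n : ℂ) • deltaSum R (n - 1) m k := by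
  unfold deltaSum
  have hA := hR.eventuallyZero n fun j => (m : ℂ) + (k - 1) - j
  have hB := hR.eventuallyZero (n - 1) fun j => (m : ℂ) + k - j
  -- The weights are split as m + k - j = k + (m - j) and n + j. After absorption the sums weighted
  -- by m - j and by j cancel.
  have h1 : ∀ j : ℕ, R' (n + j) (m + k - j)
      = ((-k : ℂ) • R (n + j) (m + (k - 1) - j)
          + (-1 : ℂ) • ((m : ℂ) - j) • R (n + j) (m + (k - 1) - j))
        + ((n : ℂ) • R (n - 1 + j) (m + k - j) + (j : ℂ) • R (n - 1 + j) (m + k - j)) := by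
    intro j
    rw [h, show n - 1 + (j : ℤ) = n + j - 1 by ring,
      show (m : ℂ) + (k - 1) - j = m + k - j - 1 by ring]
    push_cast
    module
  simp only [h1]
  rw [binomSum_add _ ((hA.smul _).add ((hA.smul _).smul _)) ((hB.smul _).add (hB.smul _)),
    binomSum_add _ (hA.smul _) ((hA.smul _).smul _), binomSum_add _ (hB.smul _) (hB.smul _),
    binomSum_smul, binomSum_smul, binomSum_smul, binomSum_sub_index_smul,
    binomSum_index_smul _ hB]
  have h2 : ∀ j : ℕ, R (n - 1 + (j + 1 : ℕ)) (m + k - (j + 1 : ℕ))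
      = R (n + j) (m + (k - 1) - j) := by
    intro j
    congr 1 <;> (push_cast; ring)
  simp only [h2]
  module

end Sums

/-! ### Propagation of vanishing along the recursions -/

/-- A family satisfying the recursions of the Borcherds defect vanishes as soon as it vanishes at a
generating set of indices. -/
lemma eq_zero_of_recursion {V A B C : Type*} [AddCommGroup C] [Module ℂ C] (TV : V → V) (TA : A → A)
    (D : V → A → B → ℤ → ℤ → ℂ → C)
    (hsucc : ∀ v a b n m k, D v a b (n + 1) m k = D v a b n (m + 1) k - D v a b n m (k + 1))
    (hleft : ∀ v a b n m k, D (TV v) a b n m k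
      = (-m : ℂ) • D v a b n (m - 1) k - (n : ℂ) • D v a b (n - 1) m k)
    (hright : ∀ v a b n m k, D v (TA a) b n m k
      = (-k : ℂ) • D v a b n m (k - 1) + (n : ℂ) • D v a b (n - 1) m k)
    (h1 : ∀ v a b (m : ℕ) k, (∀ i : ℕ, k ≠ -((i : ℂ) + 1)) → D v a b 0 m k = 0)
    (h2 : ∀ v a b (m : ℕ), D v a b 0 m (-1) = 0)
    (h3 : ∀ v a b k, (∀ i : ℕ, k ≠ -((i : ℂ) + 1)) → D v a b 0 (-1) k = 0)
    (h4 : ∀ v a b, D v a b 0 (-1) (-1) = 0)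
    (h5 : ∀ v a b k, (∀ i : ℕ, k ≠ -((i : ℂ) + 1)) → D v a b (-1) 0 k = 0)
    (h6 : ∀ v a b, D v a b (-1) 0 (-1) = 0) (v : V) (a : A) (b : B) (n m : ℤ) (k : ℂ) :
    D v a b n m k = 0 := by
  have hne : ∀ i : ℕ, (-((i : ℂ) + 1)) ≠ 0 := fun i => by
    rw [neg_ne_zero]; exact_mod_cast i.succ_ne_zero
  -- For n = 0 the last term of `hright` disappears, and the vanishing passes from k to k - 1
  -- because the factor -k is nonzero for negative k.
  have hneg : ∀ m : ℤ, (∀ v a b, D v a b 0 m (-1) = 0) →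
      ∀ (i : ℕ) v a b, D v a b 0 m (-((i : ℂ) + 1)) = 0 := by
    intro m hm i
    induction i with
    | zero => simpa using hm
    | succ i ih =>
      intro v a b
      have h := hright v a b 0 m (-((i : ℂ) + 1))
      rw [ih, Int.cast_zero, zero_smul, add_zero, eq_comm, smul_eq_zero, neg_eq_zero] at h
      rw [← h.resolve_left (hne i)]
      push_cast
      congr 1
      ring
  have hall : ∀ m : ℤ, (∀ v a b k, (∀ i : ℕ, k ≠ -((i : ℂ) + 1)) → D v a b 0 m k = 0) →
      (∀ v a b, D v a b 0 m (-1) = 0) → ∀ v a b k, D v a b 0 m k = 0 := by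
    intro m hm hm' v a b k
    by_cases hk : ∃ i : ℕ, k = -((i : ℂ) + 1)
    · obtain ⟨i, rfl⟩ := hk
      exact hneg m hm' i v a b
    · exact hm v a b k fun i hi => hk ⟨i, hi⟩
  -- In the same way `hleft` at n = 0 passes from m to m - 1 for negative m.
  have hz : ∀ (i : ℕ) v a b k, D v a b 0 (-((i : ℤ) + 1)) k = 0 := by
    intro i
    induction i with
    | zero => simpa using hall (-1) h3 h4
    | succ i ih =>
      intro v a b k
      have h := hleft v a b 0 (-((i : ℤ) + 1)) k
      rw [ih, Int.cast_zero, zero_smul, sub_zero, eq_comm, smul_eq_zero, neg_eq_zero] at h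
      rw [← h.resolve_left (by exact_mod_cast hne i)]
      push_cast
      congr 1
  have h0 : ∀ v a b (m : ℤ) k, D v a b 0 m k = 0 := by
    intro v a b m k
    rcases Int.le_total 0 m with hm | hm
    · lift m to ℕ using hm
      exact hall m (fun v a b => h1 v a b m) (fun v a b => h2 v a b m) v a b k
    · obtain ⟨i, rfl⟩ : ∃ i : ℕ, m = -(i : ℤ) := ⟨m.natAbs, by omega⟩
      cases i with
      | zero => exact hall 0 (fun v a b => h1 v a b 0) (fun v a b => h2 v a b 0) v a b k
      | succ i => exact_mod_cast hz i v a b k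
  have hm1 : ∀ (i : ℕ) v a b, D v a b (-1) 0 (-((i : ℂ) + 1)) = 0 := by
    intro i
    induction i with
    | zero => simpa using h6
    | succ i ih =>
      intro v a b
      -- Both recursions involve the still unknown value at n = -2, with opposite signs. In their
      -- sum only the value at k - 1 remains, since m = 0 kills the other term.
      have h := congrArg₂ (· + ·) (hleft v a b (-1) 0 (-((i : ℂ) + 1)))
        (hright v a b (-1) 0 (-((i : ℂ) + 1)))
      simp only [ih, Int.cast_zero, neg_zero, zero_smul, add_zero, zero_sub] at h
      have h' : (-(-((i : ℂ) + 1))) • D v a b (-1) 0 (-((i : ℂ) + 1) - 1) = 0 := by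
        rw [eq_comm] at h
        simpa [add_comm, add_assoc] using h
      rw [smul_eq_zero, neg_eq_zero] at h'
      rw [← h'.resolve_left (hne i)]
      push_cast
      congr 1
      ring
  have hneg1 : ∀ v a b (m : ℤ) k, D v a b (-1) m k = 0 := by
    have hbase : ∀ v a b k, D v a b (-1) 0 k = 0 := by
      intro v a b k
      by_cases hk : ∃ i : ℕ, k = -((i : ℂ) + 1)
      · obtain ⟨i, rfl⟩ := hk
        exact hm1 i v a b
      · exact h5 v a b k fun i hi => hk ⟨i, hi⟩
    -- Since D vanishes at n = 0, its values at n = -1 depend only on m + k, which reduces them to m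
    -- = 0.
    have hstep : ∀ v a b (m : ℤ) k, D v a b (-1) (m + 1) k = D v a b (-1) m (k + 1) := by
      intro v a b m k
      have h := hsucc v a b (-1) m k
      rw [neg_add_cancel, h0] at h
      exact (sub_eq_zero.1 h.symm)
    intro v a b m
    induction m using Int.induction_on with
    | zero => exact hbase v a b
    | succ i ih => intro k; rw [hstep, ih]
    | pred i ih =>
      intro k
      have h := hstep v a b (-(i : ℤ) - 1) (k - 1)
      rw [sub_add_cancel, sub_add_cancel, ih] at h
      exact h.symm
  -- Upwards from n = 0 by `hsucc`; downwards from n = -1 by `hleft`, where the value at n - 1 has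
  -- the nonzero factor n.
  rcases Int.le_total 0 n with hn | hn
  · lift n to ℕ using hn
    induction n generalizing m k with
    | zero => exact h0 v a b m k
    | succ n ih => push_cast; rw [hsucc, ih, ih, sub_zero]
  · obtain ⟨i, rfl⟩ : ∃ i : ℕ, n = -(i : ℤ) := ⟨n.natAbs, by omega⟩
    cases i with
    | zero => exact h0 v a b m k
    | succ i =>
      clear hn
      induction i generalizing v m k with
      | zero => exact hneg1 v a b m k
      | succ i ih =>
        have h := hleft v a b (-((i + 1 : ℕ) : ℤ)) m k
        rw [ih, ih, smul_zero, zero_sub, eq_comm, neg_eq_zero, smul_eq_zero] at h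
        rw [← h.resolve_left (by have := hne i; push_cast; exact this)]
        push_cast
        congr 1

/-! ## Modes of vertex modules -/

section Modules

variable {V : Type*} [AddCommGroup V] [Module ℂ V] {A : VertexAlgebra V}
  {M : Type*} [AddCommGroup M] [Module ℂ M] (W : VertexModule A M)

lemma VertexModule.exists_mode_eq_zero (v : V) (x : M) (s : ℤ) :
    ∃ N : ℕ, ∀ j ≥ N, W.mode (s + (j : ℕ)) v x = 0 := by
  set o := HahnSeries.order ((HahnModule.of ℂ).symm (W.Y v x))
  refine ⟨(-o - s).toNat, fun j hj => ?_⟩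
  exact VertexOperator.ncoeff_eq_zero_of_lt_order (W.Y v) _ x (by omega)

lemma VertexModule.mode_vac (n : ℤ) (x : M) : W.mode n A.vac x = if n = -1 then x else 0 :=
  W.vac_mode n x

lemma VertexModule.T_mode (v : V) (n : ℤ) (x : M) :
    W.T (W.mode n v x) = W.mode n v (W.T x) + (-n : ℂ) • W.mode (n - 1) v x := by
  have h : W.T (W.mode n v x) - W.mode n v (W.T x) = -n • W.mode (n - 1) v x :=
    W.translation v n x
  rw [sub_eq_iff_eq_add'] at h
  rw [h, ← Int.cast_smul_eq_zsmul ℂ]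
  push_cast
  rfl

/-- Not an axiom of modules: this is the Borcherds identity for v and the vacuum at indices (-2, 0,
n). The modes of the vacuum leave at most one term on the left, with coefficient (-1)^j binom(-2, j)
= j + 1. -/
lemma VertexModule.mode_T (v : V) (n : ℤ) (x : M) :
    W.mode n (A.T v) x = (-n : ℂ) • W.mode (n - 1) v x := by
  have h : ∑ᶠ j : ℕ, ((-1) ^ j * Ring.choose (-2 : ℤ) j) •
        (W.mode (0 + (-2) - j) v (W.mode (n + j) A.vac x)
          - ((-2 : ℤ).negOnePow : ℤ) • W.mode (((-2 : ℤ) : ℤ) + n - j) A.vac (W.mode (0 + j) v x))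
      = ∑ᶠ j : ℕ, Ring.choose (0 : ℤ) j •
        W.mode (((0 : ℤ) : ℤ) + n - j) (A.mode (-2 + j) v A.vac) x :=
    W.borcherds v A.vac x (-2) 0 n
  have hchoose : ∀ j : ℕ, ((-1) ^ j * Ring.choose (-2 : ℤ) j) = (j : ℤ) + 1 := by
    intro j
    have h1 := succ_mul_choose_succ (-1 : ℤ) j
    rw [choose_neg_one] at h1
    norm_num at h1
    have h2 : ((-1 : ℤ) ^ j) * (-1) ^ j = 1 := by rw [← mul_pow]; simp
    rw [pow_succ] at h1
    linear_combination ((-1 : ℤ) ^ j) * h1 + ((j : ℤ) + 1) * h2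
  have hR : ∑ᶠ j : ℕ, Ring.choose (0 : ℤ) j •
      W.mode (((0 : ℤ) : ℤ) + n - j) (A.mode (-2 + j) v A.vac) x = W.mode n (A.T v) x := by
    rw [finsum_eq_single _ 0]
    · simp only [Ring.choose_zero_right, one_smul, zero_add, Nat.cast_zero, sub_zero,
        add_zero]
      rfl
    · intro j hj
      obtain ⟨i, rfl⟩ := Nat.exists_eq_succ_of_ne_zero hj
      simp [Ring.choose_zero_succ]
  have he : ((-2 : ℤ).negOnePow : ℤ) = 1 := by rw [Int.negOnePow_even _ (by decide)]; rfl
  rw [hR] at h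
  rw [← h]
  simp only [hchoose, he, one_smul, VertexModule.mode_vac]
  -- The vacuum acts nontrivially only through its mode -1: at j = -1 - n in the first product, at j
  -- = n - 1 in the second, and nowhere if n = 0.
  rcases lt_trichotomy n 0 with hn | rfl | hn
  · obtain ⟨i, rfl⟩ : ∃ i : ℕ, n = -1 - i := ⟨(-1 - n).toNat, by omega⟩
    rw [finsum_eq_single _ i]
    · rw [if_pos (by ring), if_neg (by omega), sub_zero, ← Int.cast_smul_eq_zsmul ℂ]
      push_cast
      congr 2
      · ring
      · congr 2; ring
    · intro j hj
      rw [if_neg (by omega), if_neg (by omega)]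
      simp
  · rw [finsum_eq_zero_of_forall_eq_zero]
    · simp
    · intro j
      rw [if_neg (by omega), if_neg (by omega)]
      simp
  · obtain ⟨i, rfl⟩ : ∃ i : ℕ, n = i + 1 := ⟨(n - 1).toNat, by omega⟩
    rw [finsum_eq_single _ i]
    · rw [if_neg (by omega), if_pos (by ring), map_zero, zero_sub, ← Int.cast_smul_eq_zsmul ℂ,
        smul_neg, ← neg_smul]
      push_cast
      congr 2
      congr 2; ring
    · intro j hj
      rw [if_neg (by omega), if_neg (by omega)]
      simp

lemma VertexModule.product_T_pow (v : V) (x : M) (j : ℕ) :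
    W.product ((A.T ^ j) v) x = (j.factorial : ℂ) • W.mode (-1 - j) v x := by
  induction j generalizing v with
  | zero => simp [VertexModule.product]
  | succ j ih =>
    rw [pow_succ, Module.End.mul_apply, ih, W.mode_T, smul_smul, Nat.factorial_succ]
    push_cast
    congr 1
    · ring
    · congr 2; ring_nf

lemma VertexModule.bracket_apply (v : V) (x : M) (j : ℕ) :
    W.bracket v x j = (j.factorial : ℂ)⁻¹ • W.mode j v x := rfl

end Modules

/-! ## Series in divided powers -/

/-- `1 / Γ(n+1)`. -/
def invFactorial (n : ℂ) : ℂ := (Complex.Gamma (n + 1))⁻¹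

lemma invFactorial_natCast (n : ℕ) : invFactorial n = (n.factorial : ℂ)⁻¹ := by
  rw [invFactorial, Complex.Gamma_nat_eq_factorial]

lemma invFactorial_zero : invFactorial 0 = 1 := by simpa using invFactorial_natCast 0

lemma invFactorial_eq_zero_iff {n : ℂ} : invFactorial n = 0 ↔ ∃ k : ℕ, n = -((k : ℂ) + 1) := by
  rw [invFactorial, inv_eq_zero, Complex.Gamma_eq_zero_iff]
  refine exists_congr fun k => ?_
  rw [← eq_sub_iff_add_eq]
  ring_nf

lemma invFactorial_neg (k : ℕ) : invFactorial (-((k : ℂ) + 1)) = 0 :=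
  invFactorial_eq_zero_iff.2 ⟨k, rfl⟩

lemma invFactorial_eq_mul (n : ℂ) : invFactorial n = (n + 1) * invFactorial (n + 1) :=
  Complex.one_div_Gamma_eq_self_mul_one_div_Gamma_add_one _

lemma invFactorial_sub_one (n : ℂ) : invFactorial (n - 1) = n * invFactorial n := by
  simpa using invFactorial_eq_mul (n - 1)

/-- Binomial coefficients as quotients of factorials, in a form without division. The functional
equation of 1/Γ holds everywhere, so the poles of Γ are included. -/
lemma choose_mul_invFactorial (k : ℂ) (i : ℕ) :
    Ring.choose (k + i) i * invFactorial (k + i) = (i.factorial : ℂ)⁻¹ * invFactorial k := by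
  induction i with
  | zero => simp
  | succ i ih =>
    have h := succ_mul_choose_succ (k + (i + 1 : ℕ)) i
    have h1 := invFactorial_sub_one (k + (i + 1 : ℕ))
    have h2 : k + (i + 1 : ℕ) - 1 = k + i := by push_cast; ring
    rw [h2] at h h1
    rw [h1] at ih
    have h3 : ((i : ℂ) + 1) ≠ 0 := by exact_mod_cast i.succ_ne_zero
    rw [Nat.factorial_succ, Nat.cast_mul, mul_inv, mul_assoc, ← ih, Nat.cast_succ,
      eq_inv_mul_iff_mul_eq₀ h3]
    push_cast at h ⊢
    linear_combination invFactorial (k + (i + 1)) * h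

section Series

variable {M : Type*} [AddCommGroup M] [Module ℂ M]

/-- The series `∑_n λ^{(n)} c_n`. -/
def dividedSeries : (ℂ → M) →ₗ[ℂ] (ℂ → M) where
  toFun c n := invFactorial n • c n
  map_add' c d := by ext n; simp
  map_smul' r c := by ext n; simp [smul_comm r]

lemma dividedSeries_apply (c : ℂ → M) (n : ℂ) : dividedSeries c n = invFactorial n • c n := rfl

/-- The projection killing the terms with exponents in `ℤ_{<0}`. -/
def dropNegative (c : ℂ → M) : ℂ → M := by
  classical exact fun n => if ∃ k : ℕ, n = -((k : ℂ) + 1) then 0 else c n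

lemma dropNegative_neg (c : ℂ → M) (k : ℕ) : dropNegative c (-((k : ℂ) + 1)) = 0 :=
  if_pos ⟨k, rfl⟩

lemma dropNegative_of_ne (c : ℂ → M) {n : ℂ} (h : ∀ k : ℕ, n ≠ -((k : ℂ) + 1)) :
    dropNegative c n = c n :=
  if_neg fun ⟨k, hk⟩ => h k hk

/-- The series with coefficients `g j` at `j ∈ ℕ`, and zero elsewhere. -/
def extendNat (g : ℕ → M) : ℂ → M := by
  classical exact fun n => if h : ∃ k : ℕ, n = k then g h.choose else 0

lemma extendNat_natCast (g : ℕ → M) (k : ℕ) : extendNat g (k : ℂ) = g k := by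
  have h : ∃ i : ℕ, (k : ℂ) = i := ⟨k, rfl⟩
  unfold extendNat
  rw [dif_pos h]
  exact congrArg g (Nat.cast_injective h.choose_spec).symm

lemma extendNat_of_ne (g : ℕ → M) {n : ℂ} (h : ∀ k : ℕ, n ≠ k) : extendNat g n = 0 :=
  dif_neg fun ⟨k, hk⟩ => h k hk

lemma neg_natCast_succ_ne (i k : ℕ) : (-((i : ℂ) + 1)) ≠ k := fun hk => by
  have h : ((k + i + 1 : ℕ) : ℂ) = 0 := by push_cast; linear_combination -hk
  exact Nat.cast_ne_zero.2 (Nat.succ_ne_zero _) h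

lemma dropNegative_extendNat (g : ℕ → M) : dropNegative (extendNat g) = extendNat g := by
  ext n
  by_cases h : ∃ k : ℕ, n = -((k : ℂ) + 1)
  · obtain ⟨k, rfl⟩ := h
    rw [dropNegative_neg, extendNat_of_ne _ (neg_natCast_succ_ne k)]
  · exact dropNegative_of_ne _ fun k hk => h ⟨k, hk⟩

lemma dividedSeries_extendNat (g : ℕ → M) :
    dividedSeries (extendNat g) = extendNat fun j => (j.factorial : ℂ)⁻¹ • g j := by
  ext n
  rw [dividedSeries_apply]
  by_cases h : ∃ k : ℕ, n = k
  · obtain ⟨k, rfl⟩ := h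
    rw [extendNat_natCast, extendNat_natCast, invFactorial_natCast]
  · have h' : ∀ k : ℕ, n ≠ k := fun k hk => h ⟨k, hk⟩
    rw [extendNat_of_ne _ h', extendNat_of_ne _ h', smul_zero]

lemma polySeries_eq_extendNat (p : ℕ →₀ M) : polySeries p = extendNat p := by
  ext n
  unfold polySeries
  by_cases h : ∃ k : ℕ, n = k
  · obtain ⟨k, rfl⟩ := h
    simp [extendNat_natCast, Finsupp.sum]
  · have h' : ∀ k : ℕ, n ≠ k := fun k hk => h ⟨k, hk⟩
    rw [extendNat_of_ne _ h']
    exact Finset.sum_eq_zero fun j _ => if_neg fun hj => h' j hj.symm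

lemma polySeries_add (p q : ℕ →₀ M) : polySeries (p + q) = polySeries p + polySeries q := by
  ext n
  exact Finsupp.sum_add_index' (by simp) (by intros; split_ifs <;> simp)

lemma polySeries_integerPart {Γ : Set ℂ} (f : LambdaSeries Γ M) :
    polySeries (integerPart f) = extendNat fun j : ℕ => (f : ℂ → M) j :=
  polySeries_eq_extendNat _

lemma polySeries_bracket {V : Type*} [AddCommGroup V] [Module ℂ V] {A : VertexAlgebra V}
    (W : VertexModule A M) (v : V) (x : M) :
    polySeries (W.bracket v x) = dividedSeries (extendNat fun j => W.mode j v x) := by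
  rw [polySeries_eq_extendNat, dividedSeries_extendNat]
  rfl

lemma mulPow_dividedSeries_one (c : ℂ → M) :
    mulPow 1 (dividedSeries c) = dividedSeries fun s => s • c (s - 1) := by
  ext n
  simp only [mulPow, dividedSeries_apply, Nat.cast_one, invFactorial_sub_one, smul_smul, mul_comm]

lemma formalDeriv_iterate_dividedSeries (c : ℂ → M) (j : ℕ) :
    formalDeriv^[j] (dividedSeries c) = dividedSeries fun s => c (s + j) := by
  induction j with
  | zero => simp
  | succ j ih =>
    rw [Function.iterate_succ_apply', ih]
    ext n
    simp only [formalDeriv, dividedSeries_apply, smul_smul, invFactorial_eq_mul n]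
    congr 2
    push_cast
    ring

/-- Integration raises the index of a divided power by one. `dropNegative` matters only at exponent
0, where c_{-1} would otherwise enter; at negative integer exponents 1/Γ already vanishes. -/
lemma integral_dividedSeries (c : ℂ → M) :
    integral (dividedSeries c) = dividedSeries fun s => dropNegative c (s - 1) := by
  ext n
  unfold integral
  split_ifs with h
  · obtain ⟨k, rfl⟩ := h
    rw [dividedSeries_apply]
    cases k with
    | zero =>
      have h1 : dropNegative c (-((0 : ℕ) : ℂ) - 1) = 0 := by
        have := dropNegative_neg c 0
        simpa using this
      rw [h1, smul_zero]
    | succ k =>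
      have h1 := invFactorial_neg k
      push_cast
      rw [h1, zero_smul]
  · have hn : n ≠ 0 := fun h0 => h ⟨0, by simpa using h0⟩
    rw [dividedSeries_apply, dividedSeries_apply, dropNegative_of_ne, invFactorial_sub_one,
      smul_smul, inv_mul_cancel_left₀ hn]
    intro k hk
    exact h ⟨k, by linear_combination hk⟩

/-! ## Linearity of the operations on series -/

/-- Multiplication by the variable. -/
def mulVar : Module.End ℂ (ℂ → M) where
  toFun f := mulPow 1 f
  map_add' _ _ := rfl
  map_smul' _ _ := rfl

lemma mulVar_apply (f : ℂ → M) : mulVar f = mulPow 1 f := rfl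

lemma mulVar_pow_apply (p : ℕ) (f : ℂ → M) : (mulVar ^ p) f = mulPow p f := by
  induction p with
  | zero => ext n; simp [mulPow]
  | succ p ih =>
    rw [pow_succ', Module.End.mul_apply, ih]
    ext n
    change f (n - (1 : ℕ) - p) = f (n - (p + 1 : ℕ))
    congr 1
    push_cast
    ring

/-- The integral as a linear map. -/
def integralLin : Module.End ℂ (ℂ → M) where
  toFun f := integral f
  map_add' f g := by ext n; simp only [integral, Pi.add_apply]; split_ifs <;> simp
  map_smul' r f := by
    ext n; simp only [integral, Pi.smul_apply, RingHom.id_apply]; split_ifs <;> simp [smul_comm r]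

/-- `∫₀^λ F(λ, μ) dμ` as a linear map. -/
def integralTwoLin : (ℕ →₀ (ℂ → M)) →ₗ[ℂ] (ℂ → M) :=
  Finsupp.lsum ℂ fun p => (mulVar ^ p) ∘ₗ integralLin

lemma integralTwoLin_apply (F : ℕ →₀ (ℂ → M)) : integralTwoLin (M := M) F = integralTwo F := by
  unfold integralTwoLin integralTwo
  rw [Finsupp.lsum_apply]
  refine Finsupp.sum_congr fun p _ => ?_
  rw [LinearMap.comp_apply, mulVar_pow_apply]
  rfl

end Series

/-! ### A binomial theorem for operators raising an index -/

section Pascal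

variable {N : Type*} [AddCommGroup N] [Module ℂ N]

lemma finsuppSum_eq_finsum {M : Type*} [AddCommGroup M] (p : ℕ →₀ M) (f : ℕ → M → N)
    (hf : ∀ j, f j 0 = 0) : p.sum f = ∑ᶠ j, f j (p j) := by
  unfold Finsupp.sum
  rw [finsum_eq_sum_of_support_subset]
  intro j hj
  rw [Finset.mem_coe, Finsupp.mem_support_iff]
  intro h
  exact hj (by simp only [h, hf])

/-- Λ acts on values and τ on arguments, so the two actions commute and the left side is (Λ + τ)^i
applied to `G 0`. By `h` each factor raises the index, and the factors i + 1 multiply to i!. This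
handles the substitutions λ - μ and -λ - T. -/
lemma sum_choose_smul_pow (Λ : Module.End ℂ N) {U : Type*} (τ : U → U) (G : ℕ → U → N)
    (h : ∀ i u, Λ (G i u) + G i (τ u) = ((i : ℂ) + 1) • G (i + 1) u) (i : ℕ) (u : U) :
    ∑ j ∈ Finset.range (i + 1), (i.choose j : ℂ) • (Λ ^ j) (G 0 (τ^[i - j] u))
      = (i.factorial : ℂ) • G i u := by
  have key : ∀ (i : ℕ) (u : U), ∑ p ∈ Finset.HasAntidiagonal.antidiagonal i, i.choose p.1 • (Λ ^ p.1) (G 0 (τ^[p.2] u))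
      = (i.factorial : ℂ) • G i u := by
    intro i
    induction i with
    | zero => intro u; simp
    | succ i ih =>
      intro u
      rw [Finset.sum_antidiagonal_choose_succ_nsmul (fun p q => (Λ ^ p) (G 0 (τ^[q] u)))]
      have h1 := ih (τ u)
      have h2 := congrArg Λ (ih u)
      rw [map_sum, map_smul] at h2
      have h3 : ∀ p ∈ Finset.HasAntidiagonal.antidiagonal i, Λ (i.choose p.1 • (Λ ^ p.1) (G 0 (τ^[p.2] u)))
          = i.choose p.2 • (Λ ^ (p.1 + 1)) (G 0 (τ^[p.2] u)) := by
        intro p hp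
        rw [map_nsmul, pow_succ', Module.End.mul_apply,
          Nat.choose_symm_of_eq_add (Finset.HasAntidiagonal.mem_antidiagonal.1 hp).symm]
      rw [Finset.sum_congr rfl h3] at h2
      simp only [Function.iterate_succ_apply]
      rw [h1, h2, ← smul_add, add_comm, h, smul_smul, Nat.factorial_succ]
      push_cast
      rw [mul_comm]
  rw [← key, Finset.Nat.sum_antidiagonal_eq_sum_range_succ_mk]
  simp only [Nat.cast_smul_eq_nsmul]

end Pascal

lemma mapCoeff_apply {M N : Type*} [AddCommGroup M] [Module ℂ M] [AddCommGroup N] [Module ℂ N]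
    (φ : M →ₗ[ℂ] N) (p : ℕ →₀ M) (j : ℕ) : mapCoeff φ p j = φ (p j) := rfl

lemma mapCoeff_zero {M N : Type*} [AddCommGroup M] [Module ℂ M] [AddCommGroup N] [Module ℂ N]
    (φ : M →ₗ[ℂ] N) : mapCoeff φ 0 = 0 := map_zero (Finsupp.mapRange.linearMap φ)

lemma mapCoeff_add {M N : Type*} [AddCommGroup M] [Module ℂ M] [AddCommGroup N] [Module ℂ N]
    (φ : M →ₗ[ℂ] N) (p q : ℕ →₀ M) : mapCoeff φ (p + q) = mapCoeff φ p + mapCoeff φ q :=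
  map_add (Finsupp.mapRange.linearMap φ) p q

lemma mapCoeff_single {M N : Type*} [AddCommGroup M] [Module ℂ M] [AddCommGroup N] [Module ℂ N]
    (φ : M →ₗ[ℂ] N) (j : ℕ) (x : M) :
    mapCoeff φ (Finsupp.single j x) = Finsupp.single j (φ x) :=
  Finsupp.mapRange_single (hf := map_zero φ)

/-! ### The Borcherds defect and the conditions as its values -/

section Conditions

variable {V M₁ M₂ M₃ : Type*} [AddCommGroup V] [Module ℂ V] [AddCommGroup M₁] [Module ℂ M₁]
  [AddCommGroup M₂] [Module ℂ M₂] [AddCommGroup M₃] [Module ℂ M₃] {A : VertexAlgebra V}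
  (W₁ : VertexModule A M₁) (W₂ : VertexModule A M₂) (W₃ : VertexModule A M₃)
  (c : M₁ →ₗ[ℂ] M₂ →ₗ[ℂ] (ℂ → M₃))

/-- The difference of the two sides of the Borcherds identity, where `c a b k` is `a_{(k)} b`. -/
def borcherdsDefect (v : V) (a : M₁) (b : M₂) (n m : ℤ) (k : ℂ) : M₃ :=
  leftSum (fun s t => W₃.mode s v (c a b t)) n m k
    - rightSum (fun t s => c a (W₂.mode s v b) t) n m k
    - deltaSum (fun s t => c (W₁.mode s v a) b t) n m k

/-- `a_{(t + j)} b` vanishes for `j` large. -/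
def ModesBounded (c : M₁ →ₗ[ℂ] M₂ →ₗ[ℂ] (ℂ → M₃)) : Prop :=
  ∀ a b t, ∃ N : ℕ, ∀ j ≥ N, c a b (t + (j : ℕ)) = 0

/-- `(Ta)_{(k)} b = -k a_{(k-1)} b`. -/
def IsTranslationCovariant (c : M₁ →ₗ[ℂ] M₂ →ₗ[ℂ] (ℂ → M₃)) : Prop :=
  ∀ a b k, c (W₁.T a) b k = (-k) • c a b (k - 1)

variable {W₁ W₂ W₃ c}

lemma leftBounded_modes (hc : ModesBounded c) (v : V) (a : M₁) (b : M₂) :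
    LeftBounded fun s t => W₃.mode s v (c a b t) := fun t => by
  obtain ⟨N, hN⟩ := hc a b t
  exact ⟨N, fun j hj s => by simp only [hN j hj, map_zero]⟩

lemma rightBounded_modes (v : V) (a : M₁) (b : M₂) :
    RightBounded fun t s => c a (W₂.mode s v b) t := fun s => by
  obtain ⟨N, hN⟩ := W₂.exists_mode_eq_zero v b s
  exact ⟨N, fun j hj t => by simp only [hN j hj, map_zero, Pi.zero_apply]⟩

lemma deltaBounded_modes (v : V) (a : M₁) (b : M₂) :
    DeltaBounded fun s t => c (W₁.mode s v a) b t := fun s => by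
  obtain ⟨N, hN⟩ := W₁.exists_mode_eq_zero v a s
  exact ⟨N, fun j hj t => by
    simp only [hN j hj, map_zero, LinearMap.zero_apply, Pi.zero_apply]⟩

/-- Splitting the left side into two sums requires each of them to be finite; this is the role of
`ModesBounded`. -/
lemma borcherdsIdentity_iff (hc : ModesBounded c) (v : V) (a : M₁) (b : M₂) :
    BorcherdsIdentity (K := ℂ) (fun n x => W₁.mode n v x) (fun n x => W₂.mode n v x)
        (fun n x => W₃.mode n v x) (fun x n y => c x y n) a b
      ↔ ∀ n m k, borcherdsDefect W₁ W₂ W₃ c v a b n m k = 0 := by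
  unfold BorcherdsIdentity borcherdsDefect
  refine forall_congr' fun n => forall_congr' fun m => forall_congr' fun k => ?_
  rw [sub_eq_zero]
  have hL : ∑ᶠ j : ℕ, ((-1) ^ j * Ring.choose n j) •
      (W₃.mode (m + n - j) v (c a b (k + j))
        - (n.negOnePow : ℤ) • c a (W₂.mode (m + j) v b) ((n : ℂ) + k - j))
      = leftSum (fun s t => W₃.mode s v (c a b t)) n m k
        - rightSum (fun t s => c a (W₂.mode s v b) t) n m k := by
    unfold leftSum rightSum
    rw [sub_eq_add_neg, ← neg_smul, ← binomSum_smul, ← binomSum_add]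
    · refine finsum_congr fun j => ?_
      rw [← Int.cast_smul_eq_zsmul ℂ, ← Int.cast_smul_eq_zsmul ℂ]
      push_cast
      module
    · exact (leftBounded_modes hc v a b).eventuallyZero _ k _
    · exact ((rightBounded_modes v a b).eventuallyZero _ m _).smul _
  have hR : ∑ᶠ j : ℕ, Ring.choose m j • c (W₁.mode (n + j) v a) b ((m : ℂ) + k - j)
      = deltaSum (fun s t => c (W₁.mode s v a) b t) n m k := by
    refine finsum_congr fun j => ?_
    rw [Int.cast_smul_eq_zsmul ℂ]
  rw [← hL, ← hR]

lemma borcherdsDefect_succ (hc : ModesBounded c) (v : V) (a : M₁) (b : M₂) (n m : ℤ) (k : ℂ) :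
    borcherdsDefect W₁ W₂ W₃ c v a b (n + 1) m k
      = borcherdsDefect W₁ W₂ W₃ c v a b n (m + 1) k
        - borcherdsDefect W₁ W₂ W₃ c v a b n m (k + 1) := by
  unfold borcherdsDefect
  rw [leftSum_succ (leftBounded_modes hc v a b), rightSum_succ (rightBounded_modes v a b),
    deltaSum_succ (deltaBounded_modes v a b)]
  abel

lemma borcherdsDefect_translation_left (hc : ModesBounded c) (v : V) (a : M₁) (b : M₂) (n m : ℤ)
    (k : ℂ) :
    borcherdsDefect W₁ W₂ W₃ c (A.T v) a b n m k
      = (-m : ℂ) • borcherdsDefect W₁ W₂ W₃ c v a b n (m - 1) k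
        - (n : ℂ) • borcherdsDefect W₁ W₂ W₃ c v a b (n - 1) m k := by
  unfold borcherdsDefect
  rw [leftSum_translation_left (leftBounded_modes hc v a b) (fun s t => W₃.mode_T v s _),
    rightSum_translation_left (rightBounded_modes v a b)
      (fun t s => by rw [W₂.mode_T, map_smul, Pi.smul_apply]),
    deltaSum_translation_left (deltaBounded_modes v a b)
      (fun t s => by rw [W₁.mode_T, map_smul, LinearMap.smul_apply, Pi.smul_apply])]
  module

lemma borcherdsDefect_translation_right (hc : ModesBounded c) (hT : IsTranslationCovariant W₁ c)
    (v : V) (a : M₁) (b : M₂) (n m : ℤ) (k : ℂ) :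
    borcherdsDefect W₁ W₂ W₃ c v (W₁.T a) b n m k
      = (-k : ℂ) • borcherdsDefect W₁ W₂ W₃ c v a b n m (k - 1)
        + (n : ℂ) • borcherdsDefect W₁ W₂ W₃ c v a b (n - 1) m k := by
  unfold borcherdsDefect
  rw [leftSum_translation_right (leftBounded_modes hc v a b)
      (fun s t => by rw [hT, map_smul]),
    rightSum_translation_right (rightBounded_modes v a b) (fun t s => hT _ _ _),
    deltaSum_translation_right (deltaBounded_modes v a b) (fun s t => by
      rw [← hT, W₁.T_mode, map_add, map_smul, LinearMap.add_apply, LinearMap.smul_apply,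
        Pi.add_apply, Pi.smul_apply]
      module)]
  module

lemma borcherdsDefect_zero_natCast (v : V) (a : M₁) (b : M₂) (m : ℕ) (k : ℂ) :
    borcherdsDefect W₁ W₂ W₃ c v a b 0 m k
      = W₃.mode m v (c a b k) - c a (W₂.mode m v b) k
        - ∑ j ∈ Finset.range (m + 1), (m.choose j : ℂ) • c (W₁.mode j v a) b (m + k - j) := by
  simp [borcherdsDefect, leftSum, rightSum, deltaSum, binomSum_zero_left, binomSum_natCast]

lemma borcherdsDefect_zero_neg_one (v : V) (a : M₁) (b : M₂) (k : ℂ) :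
    borcherdsDefect W₁ W₂ W₃ c v a b 0 (-1) k
      = W₃.mode (-1) v (c a b k) - c a (W₂.mode (-1) v b) k
        - ∑ᶠ j : ℕ, (-1 : ℂ) ^ j • c (W₁.mode j v a) b (k - 1 - j) := by
  simp [borcherdsDefect, leftSum, rightSum, deltaSum, binomSum_zero_left, binomSum_neg_one,
    neg_add_eq_sub]

lemma borcherdsDefect_neg_one_zero (v : V) (a : M₁) (b : M₂) (k : ℂ) :
    borcherdsDefect W₁ W₂ W₃ c v a b (-1) 0 k
      = ∑ᶠ j : ℕ, W₃.mode (-1 - j) v (c a b (k + j))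
        + ∑ᶠ j : ℕ, c a (W₂.mode j v b) (k - 1 - j) - c (W₁.mode (-1) v a) b k := by
  -- binom(-1, j) = (-1)^j cancels the signs of the expansion of (z₁ - z₂)^{-1}.
  have h : ∀ j : ℕ, (-1 : ℂ) ^ j * (-1 : ℂ) ^ j = 1 := fun j => by rw [← mul_pow]; simp
  simp [borcherdsDefect, leftSum, rightSum, deltaSum, binomSum_zero_left, binomSum_neg_one,
    neg_add_eq_sub, smul_smul, h]

lemma IsTranslationCovariant.pow (hT : IsTranslationCovariant W₁ c) (a : M₁) (b : M₂) (j : ℕ) :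
    c ((W₁.T ^ j) a) b (-1) = (j.factorial : ℂ) • c a b (-1 - j) := by
  induction j generalizing a with
  | zero => simp
  | succ j ih =>
    rw [pow_succ, Module.End.mul_apply, ih, hT, smul_smul, Nat.factorial_succ]
    push_cast
    congr 1 <;> ring_nf

variable {Γ : Set ℂ} {br : M₁ →ₗ[ℂ] M₂ →ₗ[ℂ] LambdaSeries Γ M₃} {pr : M₁ →ₗ[ℂ] M₂ →ₗ[ℂ] M₃}

/-- `choose_mul_invFactorial` turns the coefficients of (λ + μ)^n into those of the commutator
formula. The scalar on the right vanishes exactly for k ∈ ℤ_{<0}, so Jacobi carries no information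
there. -/
lemma jacobi_sub (hbr : ∀ a b, (br a b : ℂ → M₃) = dividedSeries (c a b))
    (v : V) (a : M₁) (b : M₂) (m : ℕ) (k : ℂ) :
    W₃.bracket v ((br a b : ℂ → M₃) k) m
      - ((br a (W₂.bracket v b m) : ℂ → M₃) k
        + substAdd (mapCoeff ((LambdaSeries Γ M₃).subtype ∘ₗ br.flip b) (W₁.bracket v a)) m k)
      = ((m.factorial : ℂ)⁻¹ * invFactorial k) • borcherdsDefect W₁ W₂ W₃ c v a b 0 m k := by
  have h1 : substAdd (mapCoeff ((LambdaSeries Γ M₃).subtype ∘ₗ br.flip b) (W₁.bracket v a)) m k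
      = ((m.factorial : ℂ)⁻¹ * invFactorial k) •
        ∑ j ∈ Finset.range (m + 1), (m.choose j : ℂ) • c (W₁.mode j v a) b (m + k - j) := by
    unfold substAdd
    rw [Finset.smul_sum]
    refine Finset.sum_congr rfl fun j hj => ?_
    have hj' : j ≤ m := Nat.lt_succ_iff.1 (Finset.mem_range.1 hj)
    have h2 : k + ((m - j : ℕ) : ℂ) = m + k - j := by
      rw [Nat.cast_sub hj']; ring
    have h3 : (mapCoeff ((LambdaSeries Γ M₃).subtype ∘ₗ br.flip b) (W₁.bracket v a)) j
        = (j.factorial : ℂ)⁻¹ • dividedSeries (c (W₁.mode j v a) b) := by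
      rw [mapCoeff_apply, VertexModule.bracket_apply,
        map_smul, LinearMap.comp_apply, LinearMap.flip_apply, Submodule.subtype_apply, hbr]
    rw [h3, Pi.smul_apply, dividedSeries_apply, smul_smul, smul_smul, smul_smul, ← h2]
    congr 1
    have h4 := choose_mul_invFactorial k (m - j)
    have h5 : (m.choose j : ℂ) * j.factorial * (m - j).factorial = m.factorial := by
      exact_mod_cast Nat.choose_mul_factorial_mul_factorial hj'
    have e1 : (j.factorial : ℂ) ≠ 0 := Nat.cast_ne_zero.2 (Nat.factorial_ne_zero _)
    have e2 : ((m - j).factorial : ℂ) ≠ 0 := Nat.cast_ne_zero.2 (Nat.factorial_ne_zero _)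
    have e3 : (m.factorial : ℂ) ≠ 0 := Nat.cast_ne_zero.2 (Nat.factorial_ne_zero _)
    rw [mul_right_comm, h4, ← mul_right_comm, mul_assoc _ (invFactorial k), mul_comm (invFactorial k),
      ← mul_assoc]
    congr 1
    field_simp
    linear_combination -h5
  rw [h1, borcherdsDefect_zero_natCast, VertexModule.bracket_apply, VertexModule.bracket_apply, hbr,
    hbr, map_smul, map_smul, dividedSeries_apply, Pi.smul_apply, dividedSeries_apply, map_smul]
  module

lemma product_mapCoeff (hpr : ∀ a b, pr a b = c a b (-1)) (v : V) (a : M₁) (b : M₂) :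
    polySeries (mapCoeff (pr a) (W₂.bracket v b))
      = extendNat fun m => (m.factorial : ℂ)⁻¹ • c a (W₂.mode m v b) (-1) := by
  rw [polySeries_eq_extendNat]
  congr 1
  ext m
  rw [mapCoeff_apply, VertexModule.bracket_apply,
    map_smul, hpr]

lemma mapCoeff_product_flip (hpr : ∀ a b, pr a b = c a b (-1)) (v : V) (a : M₁) (b : M₂) :
    polySeries (mapCoeff (pr.flip b) (W₁.bracket v a))
      = extendNat fun m => (m.factorial : ℂ)⁻¹ • c (W₁.mode m v a) b (-1) := by
  rw [polySeries_eq_extendNat]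
  congr 1
  ext m
  rw [mapCoeff_apply, VertexModule.bracket_apply,
    map_smul, LinearMap.flip_apply, hpr]

end Conditions

section Conditions

variable {V M₁ M₂ M₃ : Type*} [AddCommGroup V] [Module ℂ V] [AddCommGroup M₁] [Module ℂ M₁]
  [AddCommGroup M₂] [Module ℂ M₂] [AddCommGroup M₃] [Module ℂ M₃] {A : VertexAlgebra V}
  {W₁ : VertexModule A M₁} {W₂ : VertexModule A M₂} {W₃ : VertexModule A M₃}
  {c : M₁ →ₗ[ℂ] M₂ →ₗ[ℂ] (ℂ → M₃)}
  {Γ : Set ℂ} {br : M₁ →ₗ[ℂ] M₂ →ₗ[ℂ] LambdaSeries Γ M₃} {pr : M₁ →ₗ[ℂ] M₂ →ₗ[ℂ] M₃}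

lemma factorial_ne_zero_complex (n : ℕ) : (n.factorial : ℂ) ≠ 0 :=
  Nat.cast_ne_zero.2 n.factorial_ne_zero

lemma integralTwo_integerPart (hbr : ∀ a b, (br a b : ℂ → M₃) = dividedSeries (c a b))
    (v : V) (a : M₁) (b : M₂) (h0 : polySeries (integerPart (br 0 b)) = 0) :
    integralTwo ((W₁.bracket v a).mapRange (fun x => polySeries (integerPart (br x b))) h0)
      = extendNat fun m => (m.factorial : ℂ)⁻¹ •
          ∑ j ∈ Finset.range m, (m.choose j : ℂ) • c (W₁.mode j v a) b (m - 1 - j) := by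
  have hint : ∀ x, integral (polySeries (integerPart (br x b)))
      = dividedSeries fun s => extendNat (fun j : ℕ => c x b j) (s - 1) := by
    intro x
    rw [polySeries_integerPart, hbr, ← dropNegative_extendNat (fun j : ℕ => c x b j),
      ← integral_dividedSeries, dividedSeries_extendNat]
    simp only [dividedSeries_apply, invFactorial_natCast]
  have hzero : ∀ p, mulPow p (integral (0 : ℂ → M₃)) = 0 := fun p => by
    rw [← mulVar_pow_apply]
    exact (map_zero ((mulVar ^ p) ∘ₗ integralLin))
  ext n
  unfold integralTwo
  rw [Finsupp.sum_mapRange_index hzero, Finsupp.sum, Finset.sum_apply]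
  have hsum : ∑ p ∈ (W₁.bracket v a).support,
        mulPow p (integral (polySeries (integerPart (br (W₁.bracket v a p) b)))) n
      = (W₁.bracket v a).sum fun p x => invFactorial (n - p) •
          extendNat (fun j : ℕ => c x b j) (n - p - 1) := by
    refine Finset.sum_congr rfl fun p _ => ?_
    rw [hint]
    rfl
  have hext : ∀ (z : ℂ), extendNat (fun j : ℕ => c (0 : M₁) b j) z = 0 := fun z => by
    by_cases h : ∃ k : ℕ, z = k
    · obtain ⟨k, rfl⟩ := h
      simp [extendNat_natCast]
    · exact extendNat_of_ne _ fun k hk => h ⟨k, hk⟩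
  rw [hsum, finsuppSum_eq_finsum _ _ fun p => by rw [hext, smul_zero]]
  by_cases h : ∃ m : ℕ, n = m
  · obtain ⟨m, rfl⟩ := h
    rw [extendNat_natCast, finsum_eq_sum_range (N := m), Finset.smul_sum]
    · refine Finset.sum_congr rfl fun j hj => ?_
      have hj' : j < m := Finset.mem_range.1 hj
      rw [show (m : ℂ) - j - 1 = ((m - j - 1 : ℕ) : ℂ) by
          rw [Nat.cast_sub (by omega), Nat.cast_sub hj'.le, Nat.cast_one],
        extendNat_natCast, ← Nat.cast_sub hj'.le, invFactorial_natCast,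
        VertexModule.bracket_apply, map_smul, LinearMap.smul_apply, Pi.smul_apply, smul_smul,
        smul_smul]
      congr 1
      · have h5 : (m.choose j : ℂ) * j.factorial * (m - j).factorial = m.factorial := by
          exact_mod_cast Nat.choose_mul_factorial_mul_factorial hj'.le
        have e1 := factorial_ne_zero_complex j
        have e2 := factorial_ne_zero_complex (m - j)
        have e3 := factorial_ne_zero_complex m
        field_simp
        linear_combination -h5
      · rw [Nat.cast_sub (by omega), Nat.cast_sub hj'.le]
        push_cast
        ring_nf
    · intro j hj
      -- For j = m the required index is -1, which is not a natural number; for j > m the factor 1/Γ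
      -- vanishes.
      rcases hj.eq_or_lt with rfl | hj
      · rw [extendNat_of_ne, smul_zero]
        intro k
        have := neg_natCast_succ_ne 0 k
        simpa using this
      · have h1 := invFactorial_neg (j - m - 1)
        rw [show (-(((j - m - 1 : ℕ) : ℂ) + 1)) = (m : ℂ) - j by
          rw [Nat.cast_sub (by omega), Nat.cast_sub hj.le]; push_cast; ring] at h1
        rw [h1, zero_smul]
  · rw [extendNat_of_ne _ fun k hk => h ⟨k, hk⟩]
    refine finsum_eq_zero_of_forall_eq_zero fun p => ?_
    rw [extendNat_of_ne, smul_zero]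
    intro k hk
    exact h ⟨k + 1 + p, by push_cast; linear_combination hk⟩

/-- In the commutator formula at k = -1 the modes of v_(j)a have index m - 1 - j. The terms j < m
have natural index and form the integral, and j = m has index -1 and is the product. Only integer
indices occur, hence the superscript 0. -/
lemma wick_product_sub (hbr : ∀ a b, (br a b : ℂ → M₃) = dividedSeries (c a b))
    (hpr : ∀ a b, pr a b = c a b (-1)) (v : V) (a : M₁) (b : M₂)
    (h0 : polySeries (integerPart (br 0 b)) = 0) :
    polySeries (W₃.bracket v (pr a b))
      - (polySeries (mapCoeff (pr a) (W₂.bracket v b))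
        + polySeries (mapCoeff (pr.flip b) (W₁.bracket v a))
        + integralTwo ((W₁.bracket v a).mapRange (fun x => polySeries (integerPart (br x b))) h0))
      = extendNat fun m => (m.factorial : ℂ)⁻¹ •
          borcherdsDefect W₁ W₂ W₃ c v a b 0 m (-1) := by
  rw [integralTwo_integerPart hbr, product_mapCoeff hpr, mapCoeff_product_flip hpr,
    polySeries_bracket, dividedSeries_extendNat, hpr]
  ext n
  simp only [Pi.sub_apply, Pi.add_apply]
  by_cases h : ∃ m : ℕ, n = m
  · obtain ⟨m, rfl⟩ := h
    simp only [extendNat_natCast, borcherdsDefect_zero_natCast]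
    rw [Finset.sum_range_succ, Nat.choose_self, Nat.cast_one, one_smul,
      show (m : ℂ) + -1 - m = -1 by ring, ← sub_eq_add_neg]
    module
  · have h' : ∀ k : ℕ, n ≠ k := fun k hk => h ⟨k, hk⟩
    simp [extendNat_of_ne _ h']

/-- The integral over [-T, 0] produces T^{j+1}/(j+1)!, which under the product becomes the mode of
index -2 - j by translation covariance. -/
lemma quasi_comm_sub (hT : IsTranslationCovariant W₁ c) (hpr : ∀ a b, pr a b = c a b (-1))
    (v : V) (a : M₁) (b : M₂) :
    W₃.product v (pr a b) - pr a (W₂.product v b)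
      - pr (integralNeg W₁.T (W₁.bracket v a)) b
      = borcherdsDefect W₁ W₂ W₃ c v a b 0 (-1) (-1) := by
  have h : pr (integralNeg W₁.T (W₁.bracket v a)) b
      = ∑ᶠ j : ℕ, (-1 : ℂ) ^ j • c (W₁.mode j v a) b (-1 - 1 - j) := by
    have h1 : pr (integralNeg W₁.T (W₁.bracket v a)) b
        = (W₁.bracket v a).sum fun j x =>
            pr.flip b (-(((j : ℂ) + 1)⁻¹ • ((-W₁.T) ^ (j + 1)) x)) := by
      rw [← LinearMap.flip_apply, integralNeg, map_finsuppSum]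
    rw [h1, finsuppSum_eq_finsum _ _ fun j => by simp]
    refine finsum_congr fun j => ?_
    have e1 := factorial_ne_zero_complex j
    have e2 : (j : ℂ) + 1 ≠ 0 := by exact_mod_cast j.succ_ne_zero
    have h2 : ((-W₁.T) ^ (j + 1)) = (-1 : ℂ) ^ (j + 1) • W₁.T ^ (j + 1) := by
      rw [← smul_pow, neg_one_smul]
    rw [h2, VertexModule.bracket_apply, LinearMap.smul_apply, map_smul, map_neg, map_smul, map_smul,
      map_smul, LinearMap.flip_apply, hpr, hT.pow, smul_smul, smul_smul, smul_smul, ← neg_smul,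
      Nat.factorial_succ]
    congr 1
    · rw [pow_succ]
      push_cast
      field_simp
    · push_cast
      ring_nf
  rw [h, borcherdsDefect_zero_neg_one, hpr, hpr]
  rfl

/-- The two integrals are the two infinite sums of the defect at (-1, 0, -1), except for the term j
= 0 of the first sum, which is v(ab). -/
lemma quasi_assoc_sub (hc : ModesBounded c) (hT : IsTranslationCovariant W₁ c)
    (hbr : ∀ a b, (br a b : ℂ → M₃) = dividedSeries (c a b))
    (hpr : ∀ a b, pr a b = c a b (-1)) (v : V) (a : M₁) (b : M₂) :
    pr (W₁.product v a) b - W₃.product v (pr a b)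
      - (integralLeft A.T W₃.product v (integerPart (br a b))
        + integralLeft W₁.T pr a (W₂.bracket v b))
      = -borcherdsDefect W₁ W₂ W₃ c v a b (-1) 0 (-1) := by
  have h1 : integralLeft A.T W₃.product v (integerPart (br a b))
      = ∑ᶠ j : ℕ, W₃.mode (-1 - (j + 1 : ℕ)) v (c a b (-1 + (j + 1 : ℕ))) := by
    unfold integralLeft
    rw [finsuppSum_eq_finsum _ _ fun j => by simp]
    refine finsum_congr fun j => ?_
    have e1 := factorial_ne_zero_complex j
    have e2 : (j : ℂ) + 1 ≠ 0 := by exact_mod_cast j.succ_ne_zero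
    have h2 : integerPart (br a b) j = (j.factorial : ℂ)⁻¹ • c a b j := by
      change (br a b : ℂ → M₃) j = _
      rw [hbr, dividedSeries_apply, invFactorial_natCast]
    rw [h2, map_smul, W₃.product_T_pow, smul_smul, smul_smul, Nat.factorial_succ,
      show (-1 : ℂ) + (j + 1 : ℕ) = j by push_cast; ring]
    push_cast
    rw [show ((j : ℂ) + 1)⁻¹ * (j.factorial : ℂ)⁻¹ * (((j : ℂ) + 1) * j.factorial) = 1 by
      field_simp, one_smul]
  have h2 : integralLeft W₁.T pr a (W₂.bracket v b)
      = ∑ᶠ j : ℕ, c a (W₂.mode j v b) (-1 - 1 - j) := by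
    unfold integralLeft
    rw [finsuppSum_eq_finsum _ _ fun j => by simp]
    refine finsum_congr fun j => ?_
    have e1 := factorial_ne_zero_complex j
    have e2 : (j : ℂ) + 1 ≠ 0 := by exact_mod_cast j.succ_ne_zero
    rw [VertexModule.bracket_apply, map_smul, hpr, hT.pow, smul_smul, smul_smul, Nat.factorial_succ]
    push_cast
    rw [show ((j : ℂ) + 1)⁻¹ * (j.factorial : ℂ)⁻¹ * (((j : ℂ) + 1) * j.factorial) = 1 by
      field_simp, one_smul]
    ring_nf
  obtain ⟨N, hN⟩ := hc a b (-1)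
  have h3 : ∑ᶠ j : ℕ, W₃.mode (-1 - j) v (c a b (-1 + j))
      = ∑ᶠ j : ℕ, W₃.mode (-1 - (j + 1 : ℕ)) v (c a b (-1 + (j + 1 : ℕ)))
        + W₃.mode (-1) v (c a b (-1)) := by
    rw [finsum_eq_sum_range (N := N + 1) fun j hj => by rw [hN j (by omega), map_zero],
      finsum_eq_sum_range (N := N) fun j hj => by rw [hN (j + 1) (by omega), map_zero],
      Finset.sum_range_succ']
    simp
  rw [h1, h2, borcherdsDefect_neg_one_zero, h3, hpr, hpr]
  simp only [VertexModule.product]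
  abel

/-! ### The non-commutative Wick formula on the left -/

/-- In coefficients of divided powers, multiplication by minus the variable. -/
def negShift (c : ℂ → M₃) : ℂ → M₃ := fun s => -(s • c (s - 1))

lemma dividedSeries_negShift_iterate (c : ℂ → M₃) (l : ℕ) :
    dividedSeries (negShift^[l] c) = (-1 : ℂ) ^ l • mulPow l (dividedSeries c) := by
  rw [← mulVar_pow_apply]
  induction l with
  | zero => simp
  | succ l ih =>
    have h : ∀ d : ℂ → M₃, dividedSeries (negShift d) = -mulVar (dividedSeries d) := by
      intro d
      change _ = -mulPow 1 (dividedSeries d)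
      rw [mulPow_dividedSeries_one, ← map_neg]
      rfl
    rw [Function.iterate_succ_apply', h, ih, map_smul, pow_succ', pow_succ', Module.End.mul_apply]
    module

/-- Lowering the index enters ℤ_{<0} only from 0, and there the factor s is zero. -/
lemma dropNegative_negShift (c : ℂ → M₃) (x : ℂ) :
    dropNegative (negShift c) x = -(x • dropNegative c (x - 1)) := by
  by_cases h : ∃ k : ℕ, x = -((k : ℂ) + 1)
  · obtain ⟨k, rfl⟩ := h
    rw [dropNegative_neg, show (-((k : ℂ) + 1) - 1) = -(((k + 1 : ℕ) : ℂ) + 1) by push_cast; ring,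
      dropNegative_neg]
    simp
  · rw [dropNegative_of_ne _ fun k hk => h ⟨k, hk⟩]
    by_cases h0 : x = 0
    · simp [h0, negShift]
    · rw [dropNegative_of_ne]
      · rfl
      · rintro k hk
        cases k with
        | zero => exact h0 (by simpa using hk)
        | succ k => exact h ⟨k, by push_cast at hk; linear_combination hk⟩

/-- Cauchy's formula for repeated integration: ∫₀^λ (λ - μ)^i f(μ) dμ is i! times the (i+1)-fold
integral of f. It is `sum_choose_smul_pow` with Λ multiplication by λ and τ multiplication by -μ
under the integral. -/
lemma sum_choose_integral (c : ℂ → M₃) (i : ℕ) :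
    ∑ j ∈ Finset.range (i + 1), (mulVar ^ (i - j))
        (integralLin (((i.choose j : ℂ) * (-1) ^ j) • mulPow j (dividedSeries c)))
      = (i.factorial : ℂ) • dividedSeries fun s => dropNegative c (s - 1 - i) := by
  rw [← sum_choose_smul_pow mulVar negShift
    (fun i c => dividedSeries fun s => dropNegative c (s - 1 - i)), ← Finset.sum_range_reflect]
  · refine Finset.sum_congr rfl fun j hj => ?_
    have hj' : j ≤ i := Nat.lt_succ_iff.1 (Finset.mem_range.1 hj)
    rw [show i + 1 - 1 - j = i - j by omega, show i - (i - j) = j by omega, Nat.choose_symm hj',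
      mul_smul, ← dividedSeries_negShift_iterate, map_smul, map_smul]
    congr 2
    change integral _ = _
    rw [integral_dividedSeries]
    simp
  · intro i d
    rw [mulVar_apply, mulPow_dividedSeries_one, ← map_add, ← map_smul]
    congr 1
    ext s
    simp only [Pi.add_apply, Pi.smul_apply, dropNegative_negShift]
    rw [show s - 1 - 1 - (i : ℂ) = s - 1 - (i + 1 : ℕ) by push_cast; ring,
      show s - 1 - (i : ℂ) - 1 = s - 1 - (i + 1 : ℕ) by push_cast; ring]
    module

lemma integralTwo_substSub (hbr : ∀ a b, (br a b : ℂ → M₃) = dividedSeries (c a b))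
    (v : V) (a : M₁) (b : M₂) (n : ℂ) :
    integralTwo (substSub (mapCoeff ((LambdaSeries Γ M₃).subtype ∘ₗ br a) (W₂.bracket v b))) n
      = invFactorial n • ∑ᶠ j : ℕ, dropNegative (c a (W₂.mode j v b)) (n - 1 - j) := by
  have hmul : ∀ j : ℕ, mulPow j (0 : ℂ → M₃) = 0 := fun j => rfl
  have h1 : integralTwo (substSub
        (mapCoeff ((LambdaSeries Γ M₃).subtype ∘ₗ br a) (W₂.bracket v b)))
      = (W₂.bracket v b).sum fun i x =>
          (i.factorial : ℂ) • dividedSeries fun s => dropNegative (c a x) (s - 1 - i) := by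
    rw [← integralTwoLin_apply, substSub]
    unfold mapCoeff
    rw [Finsupp.mapRange.linearMap_apply, Finsupp.sum_mapRange_index, map_finsuppSum]
    · refine Finsupp.sum_congr fun i _ => ?_
      rw [map_sum, ← sum_choose_integral]
      refine Finset.sum_congr rfl fun j _ => ?_
      rw [integralTwoLin, Finsupp.lsum_single, LinearMap.comp_apply, LinearMap.comp_apply,
        Submodule.subtype_apply, hbr]
    · intro i
      simp [hmul]
  have hdrop : ∀ z, dropNegative (c a 0) z = 0 := fun z => by
    unfold dropNegative
    simp
  rw [h1, Finsupp.sum, Finset.sum_apply]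
  change ((W₂.bracket v b).sum fun i x =>
    (i.factorial : ℂ) • invFactorial n • dropNegative (c a x) (n - 1 - i)) = _
  rw [finsuppSum_eq_finsum _ _ fun j => by rw [hdrop, smul_zero, smul_zero], smul_finsum]
  refine finsum_congr fun j => ?_
  have hs : dropNegative (c a (W₂.bracket v b j)) (n - 1 - j)
      = (j.factorial : ℂ)⁻¹ • dropNegative (c a (W₂.mode j v b)) (n - 1 - j) := by
    rw [VertexModule.bracket_apply, map_smul]
    unfold dropNegative
    split_ifs <;> simp
  rw [hs, smul_comm, smul_inv_smul₀ (factorial_ne_zero_complex j)]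

/-- For a natural number n the sum on the right is cut at j = n: the tail, with negative mode
indices, comes from (e^{T∂_λ} a)[v_λ b], and the head from the integral. For other n no index n - 1
- j lies in ℤ_{<0}, and the first sum is zero. -/
lemma finsum_extendNat_add_finsum_dropNegative (φ : M₂ →ₗ[ℂ] (ℂ → M₃)) (g : ℕ → M₂)
    (hg : EventuallyZero g) (n : ℂ) (hn : ∀ k : ℕ, n ≠ -((k : ℂ) + 1)) :
    ∑ᶠ j : ℕ, φ (extendNat g (n + j)) (-1 - j) + ∑ᶠ j : ℕ, dropNegative (φ (g j)) (n - 1 - j)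
      = ∑ᶠ j : ℕ, φ (g j) (n - 1 - j) := by
  obtain ⟨N, hN⟩ := hg
  by_cases h : ∃ m : ℕ, n = m
  · obtain ⟨m, rfl⟩ := h
    have h1 : ∀ j : ℕ, φ (extendNat g ((m : ℂ) + j)) (-1 - j) = φ (g (m + j)) (-1 - j) := by
      intro j
      rw [← Nat.cast_add, extendNat_natCast]
    have h2 : ∀ j ≥ m, dropNegative (φ (g j)) ((m : ℂ) - 1 - j) = 0 := by
      intro j hj
      rw [show (m : ℂ) - 1 - j = -(((j - m : ℕ) : ℂ) + 1) by
        rw [Nat.cast_sub hj]; ring, dropNegative_neg]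
    simp only [h1]
    rw [finsum_eq_sum_range (N := N) fun j hj => by rw [hN _ (by omega), map_zero, Pi.zero_apply],
      finsum_eq_sum_range h2,
      finsum_eq_sum_range (N := m + N) fun j hj => by
        rw [hN _ (by omega), map_zero, Pi.zero_apply],
      Finset.sum_range_add, add_comm]
    congr 1
    · refine Finset.sum_congr rfl fun j hj => dropNegative_of_ne _ fun k hk => ?_
      have hj' := Finset.mem_range.1 hj
      have h3 : ((m + k : ℕ) : ℂ) = (j : ℕ) := by push_cast; linear_combination hk
      have := Nat.cast_injective h3
      omega
    · refine Finset.sum_congr rfl fun j hj => ?_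
      push_cast
      ring_nf
  · have h1 : ∀ j : ℕ, φ (extendNat g (n + j)) (-1 - j) = 0 := by
      intro j
      rw [extendNat_of_ne, map_zero, Pi.zero_apply]
      intro k hk
      rcases le_or_gt j k with hjk | hjk
      · exact h ⟨k - j, by rw [Nat.cast_sub hjk]; linear_combination hk⟩
      · refine hn (j - k - 1) ?_
        rw [Nat.cast_sub (by omega), Nat.cast_sub hjk.le]
        push_cast
        linear_combination hk
    rw [finsum_eq_zero_of_forall_eq_zero h1, zero_add]
    refine finsum_congr fun j => dropNegative_of_ne _ fun k hk => ?_
    rcases le_or_gt k j with hjk | hjk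
    · exact h ⟨j - k, by rw [Nat.cast_sub hjk]; linear_combination hk⟩
    · refine hn (k - j - 1) ?_
      rw [Nat.cast_sub (by omega), Nat.cast_sub hjk.le]
      push_cast
      linear_combination hk

lemma wick_left_sub (hT : IsTranslationCovariant W₁ c)
    (hbr : ∀ a b, (br a b : ℂ → M₃) = dividedSeries (c a b))
    (hpr : ∀ a b, pr a b = c a b (-1)) (v : V) (a : M₁) (b : M₂) :
    (br (W₁.product v a) b : ℂ → M₃)
      - (expLeft A.T W₃.product v (br a b : ℂ → M₃)
        + expLeft W₁.T pr a (polySeries (W₂.bracket v b))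
        + integralTwo (substSub
            (mapCoeff ((LambdaSeries Γ M₃).subtype ∘ₗ br a) (W₂.bracket v b))))
      = dividedSeries fun k => -borcherdsDefect W₁ W₂ W₃ c v a b (-1) 0 k := by
  ext n
  have h1 : expLeft A.T W₃.product v (br a b : ℂ → M₃) n
      = invFactorial n • ∑ᶠ j : ℕ, W₃.mode (-1 - j) v (c a b (n + j)) := by
    unfold expLeft
    rw [smul_finsum]
    refine finsum_congr fun j => ?_
    rw [hbr, formalDeriv_iterate_dividedSeries, dividedSeries_apply, map_smul, W₃.product_T_pow,
      smul_comm, inv_smul_smul₀ (factorial_ne_zero_complex j)]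
  have h2 : expLeft W₁.T pr a (polySeries (W₂.bracket v b)) n
      = invFactorial n •
        ∑ᶠ j : ℕ, c a (extendNat (fun j : ℕ => W₂.mode j v b) (n + j)) (-1 - j) := by
    unfold expLeft
    rw [smul_finsum]
    refine finsum_congr fun j => ?_
    rw [polySeries_bracket, formalDeriv_iterate_dividedSeries, dividedSeries_apply, map_smul, hpr,
      hT.pow, smul_comm, inv_smul_smul₀ (factorial_ne_zero_complex j)]
  rw [Pi.sub_apply, Pi.add_apply, Pi.add_apply, h1, h2, integralTwo_substSub hbr,
    dividedSeries_apply, hbr, dividedSeries_apply]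
  -- At n ∈ ℤ_{<0} every term carries the factor 1/Γ(n+1) = 0; the splitting of sums is needed only
  -- elsewhere.
  by_cases hn : ∃ k : ℕ, n = -((k : ℂ) + 1)
  · rw [invFactorial_eq_zero_iff.2 hn]
    simp
  · have hg : EventuallyZero fun j : ℕ => W₂.mode j v b := by
      obtain ⟨N, hN⟩ := W₂.exists_mode_eq_zero v b 0
      exact ⟨N, fun j hj => by simpa using hN j hj⟩
    rw [borcherdsDefect_neg_one_zero,
      ← finsum_extendNat_add_finsum_dropNegative (c a) _ hg n fun k hk => hn ⟨k, hk⟩]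
    simp only [VertexModule.product]
    module

/-! ### The non-commutative Wick formula on the right -/

/-- `u · b + ∫₀^λ [u_μ b] dμ`, shifted by `i`. -/
def shiftedSeries (c : M₁ →ₗ[ℂ] M₂ →ₗ[ℂ] (ℂ → M₃)) (b : M₂) (i : ℕ) : M₁ →ₗ[ℂ] (ℂ → M₃) where
  toFun u := dividedSeries fun s => c u b (s - 1 - i)
  map_add' u w := by ext n; simp [dividedSeries_apply]
  map_smul' r u := by ext n; simp [dividedSeries_apply, smul_comm r]

lemma shiftedSeries_apply (b : M₂) (i : ℕ) (u : M₁) (n : ℂ) :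
    shiftedSeries c b i u n = invFactorial n • c u b (n - 1 - i) := rfl

/-- The product supplies the constant term that the integral drops, so the two together are a pure
index shift. -/
lemma polySeries_single_zero_add_integral (hbr : ∀ a b, (br a b : ℂ → M₃) = dividedSeries (c a b))
    (hpr : ∀ a b, pr a b = c a b (-1)) (u : M₁) (b : M₂) :
    polySeries (Finsupp.single 0 (pr u b)) + integral (br u b : ℂ → M₃)
      = shiftedSeries c b 0 u := by
  rw [hbr, integral_dividedSeries, polySeries_eq_extendNat, hpr]
  ext n
  rw [Pi.add_apply, dividedSeries_apply, shiftedSeries_apply, Nat.cast_zero, sub_zero]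
  by_cases h0 : n = 0
  · subst h0
    have h1 := extendNat_natCast (Finsupp.single 0 (c u b (-1))) 0
    have h2 := dropNegative_neg (c u b) 0
    simp only [Nat.cast_zero, Finsupp.single_eq_same, zero_add] at h1 h2
    rw [h1, zero_sub, h2, invFactorial_zero]
    simp
  · have h1 : extendNat (Finsupp.single 0 (c u b (-1))) n = 0 := by
      by_cases h : ∃ k : ℕ, n = k
      · obtain ⟨k, rfl⟩ := h
        rw [extendNat_natCast, Finsupp.single_eq_of_ne]
        exact fun hk => h0 (by simp [hk])
      · exact extendNat_of_ne _ fun k hk => h ⟨k, hk⟩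
    rw [h1, zero_add]
    by_cases hn : ∃ k : ℕ, n = -((k : ℂ) + 1)
    · rw [invFactorial_eq_zero_iff.2 hn, zero_smul, zero_smul]
    · rw [dropNegative_of_ne]
      intro k hk
      cases k with
      | zero => exact h0 (by simpa using hk)
      | succ k => exact hn ⟨k, by push_cast at hk; linear_combination hk⟩

lemma mulVar_pow_polySeries_single (j : ℕ) (x : M₃) :
    (mulVar ^ j) (polySeries (Finsupp.single 0 x)) = polySeries (Finsupp.single j x) := by
  rw [mulVar_pow_apply]
  ext n
  simp only [mulPow, polySeries]
  rw [Finsupp.sum_single_index (by simp), Finsupp.sum_single_index (by simp)]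
  congr 1
  rw [Nat.cast_zero, eq_comm (a := (0 : ℂ)), sub_eq_zero, eq_comm (a := n)]

/-- `∑_j λ^j x_j ↦ ∑_j λ^j (x_j · b + ∫₀^λ [(x_j)_μ b] dμ)`. -/
def productAddIntegral (c : M₁ →ₗ[ℂ] M₂ →ₗ[ℂ] (ℂ → M₃)) (b : M₂) :
    (ℕ →₀ M₁) →ₗ[ℂ] (ℂ → M₃) :=
  Finsupp.lsum ℂ fun j => (mulVar ^ j : Module.End ℂ (ℂ → M₃)) ∘ₗ shiftedSeries c b 0

lemma productAddIntegral_single (c : M₁ →ₗ[ℂ] M₂ →ₗ[ℂ] (ℂ → M₃)) (b : M₂) (j : ℕ) (x : M₁) :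
    productAddIntegral c b (Finsupp.single j x) = (mulVar ^ j) (shiftedSeries c b 0 x) := by
  rw [productAddIntegral, Finsupp.lsum_single, LinearMap.comp_apply]

lemma polySeries_add_integralTwo (hbr : ∀ a b, (br a b : ℂ → M₃) = dividedSeries (c a b))
    (hpr : ∀ a b, pr a b = c a b (-1)) (b : M₂) (q : ℕ →₀ M₁) :
    polySeries (mapCoeff (pr.flip b) q)
        + integralTwo (mapCoeff ((LambdaSeries Γ M₃).subtype ∘ₗ br.flip b) q)
      = productAddIntegral c b q := by
  rw [← integralTwoLin_apply]
  induction q using Finsupp.induction_linear with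
  | zero =>
    rw [mapCoeff_zero, mapCoeff_zero, map_zero, map_zero, add_zero]
    rfl
  | add p q hp hq =>
    rw [mapCoeff_add, mapCoeff_add, map_add, map_add, polySeries_add, ← hp, ← hq]
    abel
  | single j x =>
    rw [mapCoeff_single, mapCoeff_single, integralTwoLin, Finsupp.lsum_single,
      productAddIntegral_single, LinearMap.comp_apply, ← polySeries_single_zero_add_integral hbr hpr, map_add,
      mulVar_pow_polySeries_single]
    rfl

/-- Expansion of (λ + T)^i with T acting on u: by translation covariance, λ outside and T inside
together shift the mode index by one, up to the factor i + 1. -/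
lemma sum_choose_shiftedSeries (hT : IsTranslationCovariant W₁ c) (b : M₂) (i : ℕ) (u : M₁) :
    ∑ j ∈ Finset.range (i + 1), (i.choose j : ℂ) •
        (mulVar ^ j) (shiftedSeries c b 0 ((W₁.T ^ (i - j)) u))
      = (i.factorial : ℂ) • shiftedSeries c b i u := by
  rw [← sum_choose_smul_pow mulVar W₁.T (fun i u => shiftedSeries c b i u)]
  · simp only [Module.End.pow_apply]
  · intro i u
    rw [mulVar_apply, show shiftedSeries c b i u = dividedSeries _ from rfl, mulPow_dividedSeries_one]
    ext n
    rw [Pi.add_apply, Pi.smul_apply, dividedSeries_apply, shiftedSeries_apply, shiftedSeries_apply,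
      hT, show n - 1 - 1 - (i : ℂ) = n - 1 - (i + 1 : ℕ) by push_cast; ring,
      show n - 1 - (i : ℂ) - 1 = n - 1 - (i + 1 : ℕ) by push_cast; ring]
    module

/-- After the expansion of -λ - T, the i! of the repeated shift cancels the 1/i! in [v_λ a]. What
remains is the alternating sum of the commutator [v_(-1), a_(k)]. -/
lemma wick_right_sub (hT : IsTranslationCovariant W₁ c)
    (hbr : ∀ a b, (br a b : ℂ → M₃) = dividedSeries (c a b))
    (hpr : ∀ a b, pr a b = c a b (-1)) (v : V) (a : M₁) (b : M₂) :
    (br a (W₂.product v b) : ℂ → M₃)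
      - ((fun n => W₃.product v ((br a b : ℂ → M₃) n))
        + polySeries (mapCoeff (pr.flip b) (skew W₁.T (W₁.bracket v a)))
        + integralTwo (mapCoeff ((LambdaSeries Γ M₃).subtype ∘ₗ br.flip b)
            (skew W₁.T (W₁.bracket v a))))
      = dividedSeries fun k => -borcherdsDefect W₁ W₂ W₃ c v a b 0 (-1) k := by
  have h1 : polySeries (mapCoeff (pr.flip b) (skew W₁.T (W₁.bracket v a)))
        + integralTwo (mapCoeff ((LambdaSeries Γ M₃).subtype ∘ₗ br.flip b)
            (skew W₁.T (W₁.bracket v a)))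
      = -(W₁.bracket v a).sum fun i x =>
          ((-1 : ℂ) ^ i * i.factorial) • shiftedSeries c b i x := by
    rw [polySeries_add_integralTwo hbr hpr, skew, map_neg, map_finsuppSum]
    congr 1
    refine Finsupp.sum_congr fun i _ => ?_
    rw [map_sum, mul_smul, ← sum_choose_shiftedSeries hT, Finset.smul_sum]
    refine Finset.sum_congr rfl fun j _ => ?_
    rw [productAddIntegral_single, map_smul, map_smul, mul_smul]
  rw [add_assoc, h1]
  ext n
  have h2 : ((W₁.bracket v a).sum fun i x =>
        ((-1 : ℂ) ^ i * i.factorial) • shiftedSeries c b i x) n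
      = invFactorial n • ∑ᶠ j : ℕ, (-1 : ℂ) ^ j • c (W₁.mode j v a) b (n - 1 - j) := by
    rw [finsuppSum_eq_finsum _ _ fun j => by rw [map_zero, smul_zero], smul_finsum]
    have hfin : (Function.support fun j : ℕ =>
        ((-1 : ℂ) ^ j * j.factorial) • shiftedSeries c b j (W₁.bracket v a j)).Finite := by
      refine (W₁.bracket v a).support.finite_toSet.subset fun j hj => ?_
      rw [Finset.mem_coe, Finsupp.mem_support_iff]
      intro h
      exact hj (by simp only [h, map_zero, smul_zero])
    rw [finsum_apply hfin]
    refine finsum_congr fun j => ?_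
    rw [Pi.smul_apply, VertexModule.bracket_apply, map_smul, Pi.smul_apply, shiftedSeries_apply,
      smul_smul, mul_assoc, mul_inv_cancel₀ (factorial_ne_zero_complex j), mul_one, smul_comm]
  rw [Pi.sub_apply, Pi.add_apply, Pi.neg_apply, h2, hbr, hbr, dividedSeries_apply,
    dividedSeries_apply, dividedSeries_apply, map_smul, borcherdsDefect_zero_neg_one]
  simp only [VertexModule.product]
  module

end Conditions

/-! ### Necessity of the conditions and injectivity -/

section Correspondence

variable {V M₁ M₂ M₃ : Type*} [AddCommGroup V] [Module ℂ V] [AddCommGroup M₁] [Module ℂ M₁]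
  [AddCommGroup M₂] [Module ℂ M₂] [AddCommGroup M₃] [Module ℂ M₃] {A : VertexAlgebra V}
  {W₁ : VertexModule A M₁} {W₂ : VertexModule A M₂} {W₃ : VertexModule A M₃}
  {Γ : Set ℂ}

/-- The modes `a_{(k)} b` of a map with values in `M₃[[z]]z^{-Γ}`. -/
def modes (Y : M₁ →ₗ[ℂ] M₂ →ₗ[ℂ] ZSeries Γ M₃) : M₁ →ₗ[ℂ] M₂ →ₗ[ℂ] (ℂ → M₃) :=
  Y.compr₂ (LinearMap.funLeft ℂ M₃ (fun k : ℂ => -k - 1) ∘ₗ (ZSeries Γ M₃).subtype)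

lemma modes_apply (Y : M₁ →ₗ[ℂ] M₂ →ₗ[ℂ] ZSeries Γ M₃) (a : M₁) (b : M₂) (k : ℂ) :
    modes Y a b k = (Y a b : ℂ → M₃) (-k - 1) := rfl

lemma apply_eq_modes (Y : M₁ →ₗ[ℂ] M₂ →ₗ[ℂ] ZSeries Γ M₃) (a : M₁) (b : M₂) (n : ℂ) :
    (Y a b : ℂ → M₃) n = modes Y a b (-n - 1) := by
  rw [modes_apply]
  ring_nf

/-- Finitely many d bound the real parts of the exponents from below. -/
lemma zSeries_bounded (f : ZSeries Γ M₃) (t : ℂ) :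
    ∃ N : ℕ, ∀ j ≥ N, (f : ℂ → M₃) (-(t + (j : ℕ)) - 1) = 0 := by
  obtain ⟨D, hD, -, hf⟩ := f.2
  obtain ⟨B, hB⟩ := (hD.image Complex.re).bddAbove
  refine ⟨⌈B - t.re⌉₊, fun j hj => ?_⟩
  by_contra h
  obtain ⟨d, hd, k, hk⟩ := hf _ h
  have h1 : d.re ≤ B := hB ⟨d, hd, rfl⟩
  have h2 := congrArg Complex.re hk
  simp only [Complex.sub_re, Complex.neg_re, Complex.add_re, Complex.natCast_re,
    Complex.one_re] at h2
  have h3 : B - t.re ≤ j := (Nat.le_ceil _).trans (by exact_mod_cast hj)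
  have h4 : (0 : ℝ) ≤ k := Nat.cast_nonneg k
  linarith

lemma modesBounded_modes (Y : M₁ →ₗ[ℂ] M₂ →ₗ[ℂ] ZSeries Γ M₃) : ModesBounded (modes Y) :=
  fun a b t => zSeries_bounded (Y a b) t

lemma isTranslationCovariant_modes_iff (Y : M₁ →ₗ[ℂ] M₂ →ₗ[ℂ] ZSeries Γ M₃) :
    IsTranslationCovariant W₁ (modes Y)
      ↔ ∀ a b, (Y (W₁.T a) b : ℂ → M₃) = formalDeriv (Y a b : ℂ → M₃) := by
  constructor
  · intro h a b
    ext n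
    rw [apply_eq_modes, h, formalDeriv, apply_eq_modes,
      show (-(-n - 1) : ℂ) = n + 1 by ring, show (-(n + 1) - 1 : ℂ) = -n - 1 - 1 by ring]
  · intro h a b k
    rw [modes_apply, h, formalDeriv, modes_apply, show -k - 1 + 1 = -k by ring,
      show -(k - 1) - 1 = -k by ring]

lemma IntertwiningOperator.bracket_apply (I : IntertwiningOperator Γ W₁ W₂ W₃) (a : M₁) (b : M₂) :
    (I.bracket a b : ℂ → M₃) = dividedSeries (modes I.Y a b) := rfl

lemma IntertwiningOperator.product_apply (I : IntertwiningOperator Γ W₁ W₂ W₃) (a : M₁) (b : M₂) :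
    I.product a b = modes I.Y a b (-1) := by
  rw [modes_apply, show (-(-1) - 1 : ℂ) = 0 by ring]
  rfl

lemma IntertwiningOperator.isTranslationCovariant (I : IntertwiningOperator Γ W₁ W₂ W₃) :
    IsTranslationCovariant W₁ (modes I.Y) :=
  (isTranslationCovariant_modes_iff I.Y).2 I.translation

lemma IntertwiningOperator.T_modes (I : IntertwiningOperator Γ W₁ W₂ W₃) (a : M₁) (b : M₂) (k : ℂ) :
    W₃.T (modes I.Y a b k) = modes I.Y (W₁.T a) b k + modes I.Y a (W₂.T b) k :=
  sub_eq_iff_eq_add.1 (I.commutator_T a b (-k - 1))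

lemma IntertwiningOperator.defect_eq_zero (I : IntertwiningOperator Γ W₁ W₂ W₃) (v : V) (a : M₁)
    (b : M₂) (n m : ℤ) (k : ℂ) : borcherdsDefect W₁ W₂ W₃ (modes I.Y) v a b n m k = 0 :=
  (borcherdsIdentity_iff (modesBounded_modes I.Y) v a b).1 (I.borcherds v a b) n m k

theorem IntertwiningOperator.isBracketProduct (hΓ : IsExponentSet Γ)
    (I : IntertwiningOperator Γ W₁ W₂ W₃) :
    IsBracketProduct W₁ W₂ W₃ I.bracket I.product where
  no_negative a b n := by
    rw [I.bracket_apply, dividedSeries_apply, invFactorial_neg, zero_smul]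
  product_eq_zero h0 := by
    ext a b
    by_contra hne
    obtain ⟨D, -, hDΓ, hf⟩ := (I.Y a b).2
    -- A nonzero coefficient of z^0 gives 0 = -d + k with d ∈ Γ, and Γ + ℤ = Γ then forces 0 ∈ Γ.
    obtain ⟨d, hd, k, hk⟩ := hf 0 hne
    have h := hΓ.add_int_mem d (hDΓ hd) (-k)
    push_cast at h
    rw [show d + -(k : ℂ) = 0 by linear_combination hk] at h
    exact h0 h
  sesquilinear_left a b := by
    rw [I.bracket_apply, I.bracket_apply, mulPow_dividedSeries_one, ← map_neg]
    congr 1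
    ext k
    rw [I.isTranslationCovariant, neg_smul]
    rfl
  sesquilinear_right a b := by
    rw [I.bracket_apply, I.bracket_apply, mulPow_dividedSeries_one]
    ext k
    simp only [Pi.add_apply, dividedSeries_apply, map_smul, I.T_modes]
    rw [I.isTranslationCovariant]
    module
  jacobi v a b m k := by
    rw [← sub_eq_zero, jacobi_sub I.bracket_apply, I.defect_eq_zero, smul_zero]
  derivation a b := by
    rw [I.product_apply, I.product_apply, I.product_apply, I.T_modes]
  quasi_assoc v a b := by
    rw [← sub_eq_zero, quasi_assoc_sub (modesBounded_modes I.Y) I.isTranslationCovariant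
      I.bracket_apply I.product_apply, I.defect_eq_zero, neg_zero]
  quasi_comm v a b := by
    rw [← sub_eq_zero, quasi_comm_sub I.isTranslationCovariant I.product_apply, I.defect_eq_zero]
  wick_product v a b := by
    rw [← sub_eq_zero, wick_product_sub I.bracket_apply I.product_apply]
    ext n
    by_cases h : ∃ m : ℕ, n = m
    · obtain ⟨m, rfl⟩ := h
      rw [extendNat_natCast, I.defect_eq_zero, smul_zero, Pi.zero_apply]
    · exact extendNat_of_ne _ fun k hk => h ⟨k, hk⟩
  wick_left v a b := by
    rw [← sub_eq_zero, wick_left_sub I.isTranslationCovariant I.bracket_apply I.product_apply]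
    simp only [I.defect_eq_zero, neg_zero]
    exact map_zero dividedSeries
  wick_right v a b := by
    rw [← sub_eq_zero, wick_right_sub I.isTranslationCovariant I.bracket_apply I.product_apply]
    simp only [I.defect_eq_zero, neg_zero]
    exact map_zero dividedSeries

/-- The modes of a translation covariant map are determined by its bracket and product. -/
lemma modes_eq_of_bracket_product {c d : M₁ →ₗ[ℂ] M₂ →ₗ[ℂ] (ℂ → M₃)}
    (hc : IsTranslationCovariant W₁ c) (hd : IsTranslationCovariant W₁ d)
    (hbr : ∀ a b, dividedSeries (c a b) = dividedSeries (d a b))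
    (hpr : ∀ a b, c a b (-1) = d a b (-1)) : c = d := by
  ext a b k
  by_cases hk : ∃ i : ℕ, k = -((i : ℂ) + 1)
  · obtain ⟨i, rfl⟩ := hk
    -- The product with T^i a sees the mode of index -1 - i, up to the factor i!.
    have h1 := hpr ((W₁.T ^ i) a) b
    rw [hc.pow, hd.pow] at h1
    have h2 := smul_right_injective M₃ (factorial_ne_zero_complex i) h1
    rwa [show -1 - (i : ℂ) = -((i : ℂ) + 1) by ring] at h2
  · have h1 := congrFun (hbr a b) k
    rw [dividedSeries_apply, dividedSeries_apply] at h1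
    exact smul_right_injective M₃ (mt invFactorial_eq_zero_iff.1 hk) h1

lemma IntertwiningOperator.ext_Y {I J : IntertwiningOperator Γ W₁ W₂ W₃} (h : I.Y = J.Y) :
    I = J := by
  cases I
  cases J
  cases h
  rfl

theorem IntertwiningOperator.eq_of_bracket_product {I J : IntertwiningOperator Γ W₁ W₂ W₃}
    (hbr : I.bracket = J.bracket) (hpr : I.product = J.product) : I = J := by
  have h : modes I.Y = modes J.Y := by
    refine modes_eq_of_bracket_product I.isTranslationCovariant J.isTranslationCovariant
      (fun a b => ?_) (fun a b => ?_)
    · rw [← I.bracket_apply, ← J.bracket_apply, hbr]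
    · rw [← I.product_apply, ← J.product_apply, hpr]
  apply IntertwiningOperator.ext_Y
  ext a b n
  rw [apply_eq_modes, h, ← apply_eq_modes]

/-! ## From brackets and products to intertwining operators -/

/-- The mode `a_{(k)} b` recovered from the bracket and the product: it is `Γ(k+1)` times the
coefficient of `λ^k` in `[a_λ b]` for `k ∉ ℤ_{<0}`, and `(T^i a / i!) · b` for `k = -i-1`. -/
def modeOf (W₁ : VertexModule A M₁) (br : M₁ →ₗ[ℂ] M₂ →ₗ[ℂ] LambdaSeries Γ M₃)
    (pr : M₁ →ₗ[ℂ] M₂ →ₗ[ℂ] M₃) (a : M₁) (b : M₂) (k : ℂ) : M₃ := by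
  classical exact
    if h : ∃ i : ℕ, k = -((i : ℂ) + 1) then
      (h.choose.factorial : ℂ)⁻¹ • pr ((W₁.T ^ h.choose) a) b
    else (invFactorial k)⁻¹ • (br a b : ℂ → M₃) k

variable {br : M₁ →ₗ[ℂ] M₂ →ₗ[ℂ] LambdaSeries Γ M₃} {pr : M₁ →ₗ[ℂ] M₂ →ₗ[ℂ] M₃}

lemma modeOf_neg (a : M₁) (b : M₂) (i : ℕ) :
    modeOf W₁ br pr a b (-((i : ℂ) + 1)) = (i.factorial : ℂ)⁻¹ • pr ((W₁.T ^ i) a) b := by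
  have h : ∃ j : ℕ, (-((i : ℂ) + 1)) = -((j : ℂ) + 1) := ⟨i, rfl⟩
  have h1 : h.choose = i := by
    have h2 := h.choose_spec
    have h3 : (i : ℂ) = h.choose := by linear_combination -h2
    exact (Nat.cast_injective h3).symm
  unfold modeOf
  rw [dif_pos h, h1]

lemma modeOf_of_ne (a : M₁) (b : M₂) {k : ℂ} (h : ∀ i : ℕ, k ≠ -((i : ℂ) + 1)) :
    modeOf W₁ br pr a b k = (invFactorial k)⁻¹ • (br a b : ℂ → M₃) k :=
  dif_neg fun ⟨i, hi⟩ => h i hi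

lemma modeOf_mem (hΓ : IsExponentSet Γ) (h0 : (0 : ℂ) ∉ Γ → pr = 0) (a : M₁) (b : M₂) :
    (fun n => modeOf W₁ br pr a b (-n - 1)) ∈ ZSeries Γ M₃ := by
  obtain ⟨D, hD, hDΓ, hf⟩ := (br a b).2
  -- The shift by 1 comes from z^{-k-1} ↔ λ^k. The point 0 accounts for the modes given by products,
  -- and is needed only if 0 ∈ Γ.
  refine ⟨(fun d => d + 1) '' D ∪ ({0} ∩ Γ), (hD.image _).union
    ((Set.finite_singleton 0).subset Set.inter_subset_left), ?_, ?_⟩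
  · rintro d (⟨e, he, rfl⟩ | hd)
    · have h := hΓ.add_int_mem e (hDΓ he) 1
      rwa [Int.cast_one] at h
    · exact hd.2
  · intro n hn
    by_cases hk : ∃ i : ℕ, -n - 1 = -((i : ℂ) + 1)
    · obtain ⟨i, hi⟩ := hk
      have hΓ0 : (0 : ℂ) ∈ Γ := by
        by_contra h
        apply hn
        beta_reduce
        rw [hi, modeOf_neg, h0 h]
        simp
      exact ⟨0, Or.inr ⟨rfl, hΓ0⟩, i, by linear_combination -hi⟩
    · beta_reduce at hn
      rw [modeOf_of_ne _ _ fun i hi => hk ⟨i, hi⟩] at hn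
      obtain ⟨d, hd, k, hk⟩ := hf _ fun h => hn (by rw [h, smul_zero])
      exact ⟨d + 1, Or.inl ⟨d, hd, rfl⟩, k, by linear_combination -hk⟩

/-- The map `𝒴` recovered from the bracket and the product. -/
def seriesOf (hΓ : IsExponentSet Γ) (W₁ : VertexModule A M₁)
    (br : M₁ →ₗ[ℂ] M₂ →ₗ[ℂ] LambdaSeries Γ M₃) (pr : M₁ →ₗ[ℂ] M₂ →ₗ[ℂ] M₃)
    (h0 : (0 : ℂ) ∉ Γ → pr = 0) : M₁ →ₗ[ℂ] M₂ →ₗ[ℂ] ZSeries Γ M₃ :=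
  LinearMap.mk₂ ℂ (fun a b => ⟨fun n => modeOf W₁ br pr a b (-n - 1), modeOf_mem hΓ h0 a b⟩)
    (fun a a' b => by
      ext n
      change modeOf W₁ br pr (a + a') b (-n - 1)
        = modeOf W₁ br pr a b (-n - 1) + modeOf W₁ br pr a' b (-n - 1)
      unfold modeOf
      split_ifs <;> simp)
    (fun r a b => by
      ext n
      change modeOf W₁ br pr (r • a) b (-n - 1) = r • modeOf W₁ br pr a b (-n - 1)
      unfold modeOf
      split_ifs <;> simp [smul_comm r])
    (fun a b b' => by
      ext n
      change modeOf W₁ br pr a (b + b') (-n - 1)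
        = modeOf W₁ br pr a b (-n - 1) + modeOf W₁ br pr a b' (-n - 1)
      unfold modeOf
      split_ifs <;> simp)
    (fun r a b => by
      ext n
      change modeOf W₁ br pr a (r • b) (-n - 1) = r • modeOf W₁ br pr a b (-n - 1)
      unfold modeOf
      split_ifs <;> simp [smul_comm r])

lemma modes_seriesOf (hΓ : IsExponentSet Γ) (h0 : (0 : ℂ) ∉ Γ → pr = 0) (a : M₁) (b : M₂) (k : ℂ) :
    modes (seriesOf hΓ W₁ br pr h0) a b k = modeOf W₁ br pr a b k := by
  rw [modes_apply]
  change modeOf W₁ br pr a b (-(-k - 1) - 1) = _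
  congr 1
  ring

namespace IsBracketProduct

lemma bracket_eq (H : IsBracketProduct W₁ W₂ W₃ br pr) (hΓ : IsExponentSet Γ) (a : M₁) (b : M₂) :
    (br a b : ℂ → M₃)
      = dividedSeries (modes (seriesOf hΓ W₁ br pr H.product_eq_zero) a b) := by
  ext k
  rw [dividedSeries_apply, modes_seriesOf]
  by_cases hk : ∃ i : ℕ, k = -((i : ℂ) + 1)
  -- At these exponents the right side vanishes through 1/Γ, and `no_negative` is what makes the
  -- bracket agree.
  · obtain ⟨i, rfl⟩ := hk
    rw [H.no_negative, invFactorial_neg, zero_smul]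
  · rw [modeOf_of_ne _ _ fun i hi => hk ⟨i, hi⟩,
      smul_inv_smul₀ (mt invFactorial_eq_zero_iff.1 hk)]

lemma product_eq (H : IsBracketProduct W₁ W₂ W₃ br pr) (hΓ : IsExponentSet Γ) (a : M₁) (b : M₂) :
    pr a b = modes (seriesOf hΓ W₁ br pr H.product_eq_zero) a b (-1) := by
  rw [modes_seriesOf]
  have h := modeOf_neg (W₁ := W₁) (br := br) (pr := pr) a b 0
  rw [Nat.cast_zero, zero_add] at h
  simp [h]

/-- For k ∈ ℤ_{<0} this is built into `modeOf`; for other k it is [Ta_λ b] = -λ[a_λ b] after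
cancelling 1/Γ(k+1). At k = 0 the unknown a_(-1) b has coefficient 0. -/
lemma isTranslationCovariant (H : IsBracketProduct W₁ W₂ W₃ br pr) (hΓ : IsExponentSet Γ) :
    IsTranslationCovariant W₁ (modes (seriesOf hΓ W₁ br pr H.product_eq_zero)) := by
  intro a b k
  by_cases hk : ∃ i : ℕ, k = -((i : ℂ) + 1)
  · obtain ⟨i, rfl⟩ := hk
    rw [modes_seriesOf, modes_seriesOf, modeOf_neg,
      show -((i : ℂ) + 1) - 1 = -(((i + 1 : ℕ) : ℂ) + 1) by push_cast; ring, modeOf_neg, pow_succ,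
      Module.End.mul_apply, smul_smul, Nat.factorial_succ]
    congr 1
    have e1 := factorial_ne_zero_complex i
    have e2 : (i : ℂ) + 1 ≠ 0 := by exact_mod_cast i.succ_ne_zero
    push_cast
    field_simp
  · have h := congrFun (H.sesquilinear_left a b) k
    rw [H.bracket_eq hΓ, H.bracket_eq hΓ, mulPow_dividedSeries_one, dividedSeries_apply,
      Pi.neg_apply, dividedSeries_apply, ← smul_neg, ← neg_smul] at h
    exact smul_right_injective M₃ (mt invFactorial_eq_zero_iff.1 hk) h

lemma T_modes (H : IsBracketProduct W₁ W₂ W₃ br pr) (hΓ : IsExponentSet Γ) (a : M₁) (b : M₂)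
    (k : ℂ) :
    W₃.T (modes (seriesOf hΓ W₁ br pr H.product_eq_zero) a b k)
      = modes (seriesOf hΓ W₁ br pr H.product_eq_zero) (W₁.T a) b k
        + modes (seriesOf hΓ W₁ br pr H.product_eq_zero) a (W₂.T b) k := by
  by_cases hk : ∃ i : ℕ, k = -((i : ℂ) + 1)
  · obtain ⟨i, rfl⟩ := hk
    rw [modes_seriesOf, modes_seriesOf, modes_seriesOf, modeOf_neg, modeOf_neg, modeOf_neg,
      map_smul, H.derivation, smul_add, ← Module.End.mul_apply, ← Module.End.mul_apply, ← pow_succ,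
      ← pow_succ']
  · have h1 := congrFun (H.sesquilinear_left a b) k
    have h2 := congrFun (H.sesquilinear_right a b) k
    have h3 : (br a (W₂.T b) : ℂ → M₃) k
        = -(br (W₁.T a) b : ℂ → M₃) k + W₃.T ((br a b : ℂ → M₃) k) := by
      rw [h1, Pi.neg_apply, neg_neg]
      exact h2
    rw [H.bracket_eq hΓ, H.bracket_eq hΓ, H.bracket_eq hΓ, dividedSeries_apply, dividedSeries_apply,
      dividedSeries_apply, map_smul, ← smul_neg, ← smul_add] at h3
    have h4 := smul_right_injective M₃ (mt invFactorial_eq_zero_iff.1 hk) h3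
    beta_reduce at h4
    rw [h4]
    abel

lemma defect_eq_zero (H : IsBracketProduct W₁ W₂ W₃ br pr) (hΓ : IsExponentSet Γ) (v : V) (a : M₁)
    (b : M₂) (n m : ℤ) (k : ℂ) :
    borcherdsDefect W₁ W₂ W₃ (modes (seriesOf hΓ W₁ br pr H.product_eq_zero)) v a b n m k = 0 := by
  have hc := modesBounded_modes (seriesOf hΓ W₁ br pr H.product_eq_zero)
  have hT := H.isTranslationCovariant hΓ
  have hbr := H.bracket_eq hΓ
  have hpr := H.product_eq hΓ
  have hinv : ∀ {k : ℂ}, (∀ i : ℕ, k ≠ -((i : ℂ) + 1)) → invFactorial k ≠ 0 :=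
    fun h h0 => (invFactorial_eq_zero_iff.1 h0).elim h
  -- The six base cases are, in order, `jacobi`, `wick_product`, `wick_right`, `quasi_comm`,
  -- `wick_left` and `quasi_assoc`.
  refine eq_zero_of_recursion (A.T) (W₁.T)
    (borcherdsDefect W₁ W₂ W₃ (modes (seriesOf hΓ W₁ br pr H.product_eq_zero)))
    (borcherdsDefect_succ hc) (borcherdsDefect_translation_left hc)
    (borcherdsDefect_translation_right hc hT) ?_ ?_ ?_ ?_ ?_ ?_ v a b n m k
  · intro v a b m k hk
    have h := jacobi_sub (W₁ := W₁) (W₂ := W₂) (W₃ := W₃) hbr v a b m k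
    rw [H.jacobi, sub_self, eq_comm, smul_eq_zero] at h
    exact h.resolve_left (mul_ne_zero (inv_ne_zero (factorial_ne_zero_complex m)) (hinv hk))
  · intro v a b m
    have h := wick_product_sub (W₁ := W₁) (W₂ := W₂) (W₃ := W₃) hbr hpr v a b
      (by rw [map_zero, LinearMap.zero_apply]; exact polySeries_integerPart_zero Γ)
    rw [H.wick_product, sub_self] at h
    have h1 := congrFun h m
    rw [extendNat_natCast, Pi.zero_apply, eq_comm, smul_eq_zero] at h1
    exact h1.resolve_left (inv_ne_zero (factorial_ne_zero_complex m))
  · intro v a b k hk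
    have h := wick_right_sub (W₁ := W₁) (W₂ := W₂) (W₃ := W₃) hT hbr hpr v a b
    rw [H.wick_right, sub_self] at h
    have h1 := congrFun h k
    rw [dividedSeries_apply, Pi.zero_apply, eq_comm, smul_eq_zero, neg_eq_zero] at h1
    exact h1.resolve_left (hinv hk)
  · intro v a b
    rw [← quasi_comm_sub hT hpr, H.quasi_comm, sub_self]
  · intro v a b k hk
    have h := wick_left_sub (W₁ := W₁) (W₂ := W₂) (W₃ := W₃) hT hbr hpr v a b
    rw [H.wick_left, sub_self] at h
    have h1 := congrFun h k
    rw [dividedSeries_apply, Pi.zero_apply, eq_comm, smul_eq_zero, neg_eq_zero] at h1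
    exact h1.resolve_left (hinv hk)
  · intro v a b
    rw [← neg_eq_zero, ← quasi_assoc_sub hc hT hbr hpr, H.quasi_assoc, sub_self]

/-- The intertwining operator with given bracket and product. -/
def intertwiningOperator (H : IsBracketProduct W₁ W₂ W₃ br pr) (hΓ : IsExponentSet Γ) :
    IntertwiningOperator Γ W₁ W₂ W₃ where
  Y := seriesOf hΓ W₁ br pr H.product_eq_zero
  commutator_T a b n := by
    rw [apply_eq_modes, apply_eq_modes, apply_eq_modes, H.T_modes hΓ, add_sub_cancel_right]
  translation := (isTranslationCovariant_modes_iff _).1 (H.isTranslationCovariant hΓ)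
  borcherds v a b := (borcherdsIdentity_iff (modesBounded_modes _) v a b).2
    (H.defect_eq_zero hΓ v a b)

lemma bracket_intertwiningOperator (H : IsBracketProduct W₁ W₂ W₃ br pr) (hΓ : IsExponentSet Γ) :
    (H.intertwiningOperator hΓ).bracket = br := by
  ext a b : 3
  rw [IntertwiningOperator.bracket_apply, H.bracket_eq hΓ]
  rfl

lemma product_intertwiningOperator (H : IsBracketProduct W₁ W₂ W₃ br pr) (hΓ : IsExponentSet Γ) :
    (H.intertwiningOperator hΓ).product = pr := by
  ext a b
  rw [IntertwiningOperator.product_apply, H.product_eq hΓ]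
  rfl

end IsBracketProduct

end Correspondence

end LambdaIntertwiner

end
-- The bijection
theorem theorem3p8 {V M₁ M₂ M₃ : Type*} [AddCommGroup V] [Module ℂ V]
    [AddCommGroup M₁] [Module ℂ M₁] [AddCommGroup M₂] [Module ℂ M₂]
    [AddCommGroup M₃] [Module ℂ M₃]
    (A : LambdaIntertwiner.VertexAlgebra V)
    (W₁ : LambdaIntertwiner.VertexModule A M₁) (W₂ : LambdaIntertwiner.VertexModule A M₂)
    (W₃ : LambdaIntertwiner.VertexModule A M₃)
    (Γ : Set ℂ) (hΓ : LambdaIntertwiner.IsExponentSet Γ) :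
    (∀ I : LambdaIntertwiner.IntertwiningOperator Γ W₁ W₂ W₃,
      LambdaIntertwiner.IsBracketProduct W₁ W₂ W₃ I.bracket I.product) ∧
    (∀ (br : M₁ →ₗ[ℂ] M₂ →ₗ[ℂ] LambdaIntertwiner.LambdaSeries Γ M₃)
      (pr : M₁ →ₗ[ℂ] M₂ →ₗ[ℂ] M₃),
      LambdaIntertwiner.IsBracketProduct W₁ W₂ W₃ br pr →
        ∃! I : LambdaIntertwiner.IntertwiningOperator Γ W₁ W₂ W₃,
          I.bracket = br ∧ I.product = pr) := by
  refine ⟨fun I => I.isBracketProduct hΓ, fun br pr H => ?_⟩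
  refine ⟨H.intertwiningOperator hΓ, ⟨H.bracket_intertwiningOperator hΓ,
    H.product_intertwiningOperator hΓ⟩, fun J hJ => ?_⟩
  apply LambdaIntertwiner.IntertwiningOperator.eq_of_bracket_product
  · rw [hJ.1, H.bracket_intertwiningOperator hΓ]
  · rw [hJ.2, H.product_intertwiningOperator hΓ]
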